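/- Let $n,d\in\mathbb N$, $\mathfrak g=\mathfrak{gl}(n,\mathbb C)$, $\mathfrak h=\mathfrak{gl}(d,\mathbb C)$, $G=\mathrm{GL}(n,\mathbb C)$, $H=\mathrm{GL}(d,\mathbb C)$, with inner products $\langle X,Y\rangle=\mathrm{tr}(XY)$. Let $R\in\mathrm{End}(\mathfrak g)$ and $\rho\in\mathrm{End}(\mathfrak h)$ be factorizable r-matrices, i.e. skew-symmetric solutions of $[RX,RY]-R([RX,Y]+[X,RY])+[X,Y]=0$. Let $\lambda\in\mathbb C$, $\lambda\neq0$. Let $M=\{(v,w^T)\mid v,w\in \mathrm{Mat}_{n\times d}(\mathbb C)\}$, with the bivector $P$ given on covectors $(x^T,\xi)\colon(v,w^T)\mapsto\mathrm{tr}(x^Tv+w^T\xi)$ and $(y^T,\eta)$ by $$P\bigl((x^T,\xi),(y^T,\eta)\bigr)=\tfrac12\mathrm{tr}\bigl(-(vx^T-\xi w^T)R(vy^T-\eta w^T)-(x^Tv-w^T\xi)\rho(y^Tv-w^T\eta)-w^Tv(y^T\xi-x^T\eta)-vw^T(\xi y^T-\eta x^T)+2\lambda(x^T\eta-y^T\xi)\bigr)$$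 (the trace being taken summand by summand), and with the actions $g\cdot(v,w^T)=(gv,w^Tg^{-1})$ of $G$ and $h\cdot(v,w^T)=(vh^{-1},hw^T)$ of $H$. Put $X_\pm=\frac12(RX\pm X)$ and let $G_R\subset G\times G$ be the connected Lie subgroup with Lie algebra $\mathfrak g_R=\{(X_+,X_-)\mid X\in\mathfrak g\}$, which is paired with $\mathfrak g$ by $\langle X,(A,B)\rangle=\mathrm{tr}(XA)-\mathrm{tr}(XB)$; define $H_\rho\subset H\times H$ in the same way. For $X\in\mathfrak g$ let $\tilde X$ be the right-invariant one-form on $G_R$ defined by $X$, and let $X_M$ be the vector field $m\mapsto\frac{d}{dt}\big|_{t=0}e^{tX}\cdot m$. A holomorphic map $J\colon U\to G_R$ on an open set $U\subseteq M$ is called a momentum map (in the sense of Lu) for the action of $G$ if $P$ is a Poisson structure on $M$, $G$ is a Poisson Lie group with the Sklyanin bracket $\langle DF,R(DK)\rangle-\langle D'F,R(D'K)\rangle$ multiplied by $-\frac12$, the action is a Poisson action, and $P(\,\cdot\,,J^*\tilde X)=X_M$ on $U$ for all $X\in\mathfrak g$; likewise for $H$, $\rho$, $H_\rho$. Let $$\Phi^G_\lambda(v,w^T)=\lambda\,\mathrm{Id}_n+vw^T,\qquad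 \Phi^H_\lambda(v,w^T)=(\lambda\,\mathrm{Id}_d+w^Tv)^{-1}.$$ Then $\Phi^G_\lambda$, viewed as a map to $G_R$ through the local identification $(g_+,g_-)\mapsto g_+g_-^{-1}$, is a momentum map for the Poisson action of $G$ on $M$, and $\Phi^H_\lambda$, viewed in the same way as a map to $H_\rho$, is a momentum map for the Poisson action of $H$ on $M$. Precisely: the set of points at which $\Phi^G_\lambda$ is (defined and) invertible and has a factorization $\Phi^G_\lambda=g_+g_-^{-1}$ with $(g_+,g_-)\in G_R$ is open and nonempty; for each point $m$ of this set and each such factorization $(g_+,g_-)$ of $\Phi^G_\lambda(m)$ there are an open neighbourhood $U$ of $m$ and a holomorphic map $J=(J_+,J_-)\colon U\to G_R$ with $J_+J_-^{-1}=\Phi^G_\lambda$ on $U$ and $J(m)=(g_+,g_-)$; and every holomorphic map $J\colon U\to G_R$ on an open set $U$ with $J_+J_-^{-1}=\Phi^G_\lambda$ is a momentum map for the action of $G$. The same holds for $\Phi^H_\lambda$ with $H_\rho$ and the action of $H$. -/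

import Mathlib

open scoped Matrix

attribute [local instance] Matrix.linftyOpNormedAddCommGroup Matrix.linftyOpNormedSpace

namespace PoissonLie

noncomputable section

/-- Square complex matrices; this is `gl(k, ℂ)`, and its units are `GL(k, ℂ)`. -/
abbrev Mat (k : ℕ) : Type := Matrix (Fin k) (Fin k) ℂ

/-- The space `M` of pairs `(v, wᵀ)` with `v` an `n × d` and `wᵀ` a `d × n` matrix. -/
abbrev PhaseSpace (n d : ℕ) : Type :=
  Matrix (Fin n) (Fin d) ℂ × Matrix (Fin d) (Fin n) ℂ

/-- The matrix representing a linear functional through the trace: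
`φ A = tr (traceDual φ * A)`. -/
def traceDual {a b : ℕ} (φ : Module.Dual ℂ (Matrix (Fin a) (Fin b) ℂ)) :
    Matrix (Fin b) (Fin a) ℂ :=
  Matrix.of fun j i => φ (Matrix.single i j 1)

theorem trace_traceDual_mul {a b : ℕ} (φ : Module.Dual ℂ (Matrix (Fin a) (Fin b) ℂ))
    (A : Matrix (Fin a) (Fin b) ℂ) : (traceDual φ * A).trace = φ A := by
  conv_rhs => rw [Matrix.matrix_eq_sum_single A]
  simp only [Matrix.trace, Matrix.diag, Matrix.mul_apply, traceDual, Matrix.of_apply, map_sum]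
  rw [Finset.sum_comm]
  refine Finset.sum_congr rfl fun i _ => Finset.sum_congr rfl fun j _ => ?_
  have h : Matrix.single i j (A i j) = A i j • Matrix.single i j (1 : ℂ) := by
    rw [Matrix.smul_single, smul_eq_mul, mul_one]
  rw [h, map_smul, smul_eq_mul, mul_comm]

/-! ### Factorizable r-matrices on `gl(k, ℂ)`, the double and the dual group -/

/-- A factorizable r-matrix on `gl(k, ℂ)` with invariant inner product `tr (X Y)`: a skew-symmetric
endomorphism which satisfies the modified classical Yang-Baxter equation. -/
structure IsRMatrix {k : ℕ} (R : Mat k →ₗ[ℂ] Mat k) : Prop where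
  skew : ∀ X Y : Mat k, (X * R Y).trace = -(R X * Y).trace
  yangBaxter : ∀ X Y : Mat k, ⁅R X, R Y⁆ - R (⁅R X, Y⁆ + ⁅X, R Y⁆) + ⁅X, Y⁆ = 0

/-- `X₊ = (R X + X) / 2`. -/
def rPlus {k : ℕ} (R : Mat k →ₗ[ℂ] Mat k) : Mat k →ₗ[ℂ] Mat k :=
  (1 / 2 : ℂ) • (R + LinearMap.id)

/-- `X₋ = (R X - X) / 2`. -/
def rMinus {k : ℕ} (R : Mat k →ₗ[ℂ] Mat k) : Mat k →ₗ[ℂ] Mat k :=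
  (1 / 2 : ℂ) • (R - LinearMap.id)

/-- The dual Lie algebra `𝔤_R = {(X₊, X₋) | X ∈ 𝔤}` inside the double `𝔤 ⊕ 𝔤`. -/
def dualAlgebra {k : ℕ} (R : Mat k →ₗ[ℂ] Mat k) : Submodule ℂ (Mat k × Mat k) :=
  LinearMap.range ((rPlus R).prod (rMinus R))

/-- The dual group `G_R`: the connected Lie subgroup of `G × G` with Lie algebra `𝔤_R`, that is, the
subgroup generated by the exponentials of the elements of `𝔤_R`. -/
def dualGroup {k : ℕ} (R : Mat k →ₗ[ℂ] Mat k) :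
    Subgroup (GL (Fin k) ℂ × GL (Fin k) ℂ) :=
  Subgroup.closure {g | ∃ a ∈ dualAlgebra R,
    (g.1 : Mat k) = NormedSpace.exp a.1 ∧ (g.2 : Mat k) = NormedSpace.exp a.2}

/-- The invariant inner product on the double `𝔤 ⊕ 𝔤`. -/
def doublePairing {k : ℕ} (a b : Mat k × Mat k) : ℂ :=
  (a.1 * b.1).trace - (a.2 * b.2).trace

/-- The right trivialization `v ↦ v p⁻¹` of a tangent vector `v` to `G × G` at `p`. -/
def rightTriv {k : ℕ} (p v : Mat k × Mat k) : Mat k × Mat k :=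
  (v.1 * p.1⁻¹, v.2 * p.2⁻¹)

/-- The right-invariant one-form defined by `X ∈ 𝔤`. At `p` its value on the tangent
vector `v ∼ exp (t ξ) p` is the pairing of `(X, X)` with `ξ`. -/
def rightForm {k : ℕ} (X : Mat k) (p : Mat k × Mat k) : Module.Dual ℂ (Mat k × Mat k) where
  toFun v := doublePairing (X, X) (rightTriv p v)
  map_add' v w := by
    simp only [doublePairing, rightTriv, Prod.fst_add, Prod.snd_add, add_mul, mul_add,
      Matrix.trace_add]
    ring
  map_smul' c v := by
    simp only [doublePairing, rightTriv, Prod.smul_fst, Prod.smul_snd, Matrix.smul_mul,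
      Matrix.mul_smul, Matrix.trace_smul, smul_eq_mul, RingHom.id_apply]
    ring

/-- `J` is a holomorphic map from the open set `U` to the Lie group `G_R`. Since `G_R` is an immersed,
possibly non-closed, Lie subgroup of `G × G`, this means a holomorphic map to `G × G` that takes values
in `G_R` and whose differential takes values in the tangent spaces `T_p G_R = 𝔤_R p`. -/
structure IsHolomorphicToDual {k : ℕ} {E : Type*} [NormedAddCommGroup E] [NormedSpace ℂ E]
    (R : Mat k →ₗ[ℂ] Mat k) (U : Set E) (J : E → Mat k × Mat k) : Prop where
  analytic : AnalyticOnNhd ℂ J U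
  mem : ∀ m ∈ U, ∃ g ∈ dualGroup R, J m = ((g.1 : Mat k), (g.2 : Mat k))
  tangent : ∀ m ∈ U, ∀ u : E, rightTriv (J m) (fderiv ℂ J m u) ∈ dualAlgebra R

/-- The pull-back `J^* X̃` at the point `m` of the right-invariant one-form defined by `X`. -/
def pullbackForm {k : ℕ} {E : Type*} [NormedAddCommGroup E] [NormedSpace ℂ E]
    (X : Mat k) (J : E → Mat k × Mat k) (m : E) : Module.Dual ℂ E :=
  (rightForm X (J m)).comp (fderiv ℂ J m).toLinearMap

/-! ### Poisson brackets on holomorphic functions, Poisson Lie groups, Poisson actions -/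

/-- `B` is a Poisson bracket on the algebra of holomorphic functions on the open set `Ω`.
(For complex-valued functions on an open set of a finite-dimensional complex vector space,
holomorphic and complex analytic are the same.) -/
structure IsPoissonBracket {E : Type*} [NormedAddCommGroup E] [NormedSpace ℂ E]
    (Ω : Set E) (B : (E → ℂ) → (E → ℂ) → E → ℂ) : Prop where
  holomorphic : ∀ F H, AnalyticOnNhd ℂ F Ω → AnalyticOnNhd ℂ H Ω → AnalyticOnNhd ℂ (B F H) Ω
  add_left : ∀ F K H, AnalyticOnNhd ℂ F Ω → AnalyticOnNhd ℂ K Ω → AnalyticOnNhd ℂ H Ω →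
    Set.EqOn (B (F + K) H) (B F H + B K H) Ω
  smul_left : ∀ (c : ℂ) (F H), AnalyticOnNhd ℂ F Ω → AnalyticOnNhd ℂ H Ω →
    Set.EqOn (B (c • F) H) (c • B F H) Ω
  skew : ∀ F H, AnalyticOnNhd ℂ F Ω → AnalyticOnNhd ℂ H Ω → Set.EqOn (B F H) (-B H F) Ω
  leibniz : ∀ F K H, AnalyticOnNhd ℂ F Ω → AnalyticOnNhd ℂ K Ω → AnalyticOnNhd ℂ H Ω →
    Set.EqOn (B (F * K) H) (F * B K H + B F H * K) Ω
  jacobi : ∀ F H K, AnalyticOnNhd ℂ F Ω → AnalyticOnNhd ℂ H Ω → AnalyticOnNhd ℂ K Ω →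
    Set.EqOn (B F (B H K) + B H (B K F) + B K (B F H)) 0 Ω

/-- The group `GL(k, ℂ)` as an open set of matrices. -/
def glSet (k : ℕ) : Set (Mat k) := {g | IsUnit g}

/-- The left-derivative `D_g F ∈ 𝔤`: `tr (D_g F * X)` is the derivative of `F (exp (t X) g)` at
`t = 0`. -/
def leftDeriv {k : ℕ} (F : Mat k → ℂ) (g : Mat k) : Mat k :=
  traceDual ((fderiv ℂ F g).toLinearMap.comp (LinearMap.mulRight ℂ g))

/-- The right-derivative `D'_g F ∈ 𝔤`: `tr (D'_g F * Y)` is the derivative of `F (g exp (t Y))` at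
`t = 0`. -/
def rightDeriv {k : ℕ} (F : Mat k → ℂ) (g : Mat k) : Mat k :=
  traceDual ((fderiv ℂ F g).toLinearMap.comp (LinearMap.mulLeft ℂ g))

/-- The Sklyanin bracket `⟨DF, R (DH)⟩ - ⟨D'F, R (D'H)⟩`. -/
def sklyanin {k : ℕ} (R : Mat k →ₗ[ℂ] Mat k) (F H : Mat k → ℂ) (g : Mat k) : ℂ :=
  (leftDeriv F g * R (leftDeriv H g)).trace - (rightDeriv F g * R (rightDeriv H g)).trace

/-- `GL(k, ℂ)` with the bracket `B` is a (complex) Poisson Lie group. -/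
structure IsPoissonLieGroup {k : ℕ} (B : (Mat k → ℂ) → (Mat k → ℂ) → Mat k → ℂ) : Prop where
  poisson : IsPoissonBracket (glSet k) B
  multiplicative : ∀ F H, AnalyticOnNhd ℂ F (glSet k) → AnalyticOnNhd ℂ H (glSet k) →
    ∀ g₁ ∈ glSet k, ∀ g₂ ∈ glSet k,
      B (fun g => F (g * g₂)) (fun g => H (g * g₂)) g₁ +
        B (fun g => F (g₁ * g)) (fun g => H (g₁ * g)) g₂ = B F H (g₁ * g₂)

/-- `act` is a Poisson action of the Poisson Lie group `(GL(k, ℂ), BG)` on `(E, BM)`. -/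
structure IsPoissonAction {k : ℕ} {E : Type*} [NormedAddCommGroup E] [NormedSpace ℂ E]
    (BG : (Mat k → ℂ) → (Mat k → ℂ) → Mat k → ℂ) (BM : (E → ℂ) → (E → ℂ) → E → ℂ)
    (act : Mat k → E → E) : Prop where
  group : IsPoissonLieGroup BG
  space : IsPoissonBracket Set.univ BM
  one_act : ∀ m, act 1 m = m
  mul_act : ∀ g ∈ glSet k, ∀ h ∈ glSet k, ∀ m, act (g * h) m = act g (act h m)
  holomorphic : AnalyticOnNhd ℂ (fun p : Mat k × E => act p.1 p.2) (glSet k ×ˢ Set.univ)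
  poisson : ∀ F H, AnalyticOnNhd ℂ F Set.univ → AnalyticOnNhd ℂ H Set.univ →
    ∀ g ∈ glSet k, ∀ m,
      BM F H (act g m) =
        BG (fun a => F (act a m)) (fun a => H (act a m)) g +
          BM (fun x => F (act g x)) (fun x => H (act g x)) m

/-- The infinitesimal action `X_M`: the derivative of `exp (t X) · m` at `t = 0`. -/
def infAction {k : ℕ} {E : Type*} [NormedAddCommGroup E] [NormedSpace ℂ E]
    (act : Mat k → E → E) (X : Mat k) (m : E) : E :=
  deriv (fun t : ℂ => act (NormedSpace.exp (t • X)) m) 0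

/-- The bracket `{F, H}(m) = P_m (dF, dH)` defined by a bivector field `P`. -/
def bracketOf {E : Type*} [NormedAddCommGroup E] [NormedSpace ℂ E]
    (P : E → Module.Dual ℂ E → Module.Dual ℂ E → ℂ) (F H : E → ℂ) (m : E) : ℂ :=
  P m (fderiv ℂ F m).toLinearMap (fderiv ℂ H m).toLinearMap

/-- The holomorphic map `J`, defined on the open set `U`, with values in the dual group `G_R`, is a
momentum map (in the sense of Lu) for the Poisson action `act` of `GL(k, ℂ)` on the Poisson space
`(E, P)`: `P (·, J^* X̃) = X_M` on `U` for all `X ∈ 𝔤`.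

The Poisson structure on `GL(k, ℂ)` is the Sklyanin bracket of `R`, rescaled by `-1/2`. -/
structure IsMomentumMap {k : ℕ} {E : Type*} [NormedAddCommGroup E] [NormedSpace ℂ E]
    (R : Mat k →ₗ[ℂ] Mat k) (P : E → Module.Dual ℂ E → Module.Dual ℂ E → ℂ)
    (act : Mat k → E → E) (U : Set E) (J : E → Mat k × Mat k) : Prop where
  poissonAction : IsPoissonAction (sklyanin ((-1 / 2 : ℂ) • R)) (bracketOf P) act
  isOpen : IsOpen U
  holomorphic : IsHolomorphicToDual R U J
  momentum : ∀ X : Mat k, ∀ m ∈ U, ∀ α : Module.Dual ℂ E,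
    P m α (pullbackForm X J m) = α (infAction act X m)

/-! ### Matrix-valued maps as maps to the dual group -/

/-- The set of points at which `Φ` is invertible and has a factorization `Φ = g₊ g₋⁻¹` with
`(g₊, g₋) ∈ G_R`. -/
def factorDomain {k : ℕ} {E : Type*} (R : Mat k →ₗ[ℂ] Mat k) (Φ : E → Mat k) : Set E :=
  {m | IsUnit (Φ m) ∧ ∃ g ∈ dualGroup R, (g.1 : Mat k) * (g.2 : Mat k)⁻¹ = Φ m}

/-- `J` represents `Φ` on the open set `U` as a map to `G_R`, through `(g₊, g₋) ↦ g₊ g₋⁻¹`. -/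
structure IsFactorization {k : ℕ} {E : Type*} [NormedAddCommGroup E] [NormedSpace ℂ E]
    (R : Mat k →ₗ[ℂ] Mat k) (Φ : E → Mat k) (U : Set E) (J : E → Mat k × Mat k) : Prop where
  isOpen : IsOpen U
  subset : U ⊆ factorDomain R Φ
  holomorphic : IsHolomorphicToDual R U J
  factor : ∀ m ∈ U, (J m).1 * (J m).2⁻¹ = Φ m

/-- The matrix-valued map `Φ`, viewed as a map to the dual group `G_R` through the (local)
identification `(g₊, g₋) ↦ g₊ g₋⁻¹` of `G_R` with `GL(k, ℂ)`, is a momentum map. It is defined on a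
nonempty open set, through every factorization of one of its values there passes a local
holomorphic factorization, and all local holomorphic factorizations are momentum maps. -/
structure RepresentsMomentumMap {k : ℕ} {E : Type*} [NormedAddCommGroup E] [NormedSpace ℂ E]
    (R : Mat k →ₗ[ℂ] Mat k) (P : E → Module.Dual ℂ E → Module.Dual ℂ E → ℂ)
    (act : Mat k → E → E) (Φ : E → Mat k) : Prop where
  isOpen : IsOpen (factorDomain R Φ)
  nonempty : (factorDomain R Φ).Nonempty
  exists_factorization : ∀ m ∈ factorDomain R Φ, ∀ g ∈ dualGroup R,
    (g.1 : Mat k) * (g.2 : Mat k)⁻¹ = Φ m →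
      ∃ U J, m ∈ U ∧ IsFactorization R Φ U J ∧ J m = ((g.1 : Mat k), (g.2 : Mat k))
  isMomentumMap : ∀ U J, IsFactorization R Φ U J → IsMomentumMap R P act U J

/-! ### The Poisson space `M`, the two actions and the two maps -/

/-- The action `g · (v, wᵀ) = (g v, wᵀ g⁻¹)` of `G = GL(n, ℂ)`. -/
def actG {n d : ℕ} (g : Mat n) (m : PhaseSpace n d) : PhaseSpace n d :=
  (g * m.1, m.2 * g⁻¹)

/-- The action `h · (v, wᵀ) = (v h⁻¹, h wᵀ)` of `H = GL(d, ℂ)`. -/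
def actH {n d : ℕ} (h : Mat d) (m : PhaseSpace n d) : PhaseSpace n d :=
  (m.1 * h⁻¹, h * m.2)

/-- The matrix `xᵀ` of the covector `α (v, wᵀ) = tr (xᵀ v + wᵀ ξ)`. -/
def covX {n d : ℕ} (α : Module.Dual ℂ (PhaseSpace n d)) : Matrix (Fin d) (Fin n) ℂ :=
  traceDual (α.comp (LinearMap.inl ℂ _ _))

/-- The matrix `ξ` of the covector `α (v, wᵀ) = tr (xᵀ v + wᵀ ξ)`. -/
def covXi {n d : ℕ} (α : Module.Dual ℂ (PhaseSpace n d)) : Matrix (Fin n) (Fin d) ℂ :=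
  traceDual (α.comp (LinearMap.inr ℂ _ _))

theorem trace_cov {n d : ℕ} (α : Module.Dual ℂ (PhaseSpace n d)) (v : Matrix (Fin n) (Fin d) ℂ)
    (wT : Matrix (Fin d) (Fin n) ℂ) :
    α (v, wT) = (covX α * v + wT * covXi α).trace := by
  rw [Matrix.trace_add, Matrix.trace_mul_comm wT, covX, covXi, trace_traceDual_mul,
    trace_traceDual_mul]
  simp only [LinearMap.comp_apply, LinearMap.inl_apply, LinearMap.inr_apply, ← map_add,
    Prod.mk_add_mk, add_zero, zero_add]

/-- The Poisson tensor on `M`, on the covectors `α = (xᵀ, ξ)` and `β = (yᵀ, η)` at `(v, wᵀ)`. -/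
def poissonTensor {n d : ℕ} (R : Mat n →ₗ[ℂ] Mat n) (ρ : Mat d →ₗ[ℂ] Mat d) (lam : ℂ)
    (m : PhaseSpace n d) (α β : Module.Dual ℂ (PhaseSpace n d)) : ℂ :=
  let v := m.1
  let wT := m.2
  let xT := covX α
  let ξ := covXi α
  let yT := covX β
  let η := covXi β
  (1 / 2 : ℂ) *
    (-((v * xT - ξ * wT) * R (v * yT - η * wT)).trace
      - ((xT * v - wT * ξ) * ρ (yT * v - wT * η)).trace
      - (wT * v * (yT * ξ - xT * η)).trace
      - (v * wT * (ξ * yT - η * xT)).trace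
      + 2 * lam * (xT * η - yT * ξ).trace)

/-- `Φ^G_λ (v, wᵀ) = λ + v wᵀ`. -/
def PhiG {n d : ℕ} (lam : ℂ) (m : PhaseSpace n d) : Mat n :=
  lam • (1 : Mat n) + m.1 * m.2

/-- `Φ^H_λ (v, wᵀ) = (λ + wᵀ v)⁻¹`. Where `λ + wᵀ v` is singular this is a singular matrix as well,
so that such points do not belong to the domain of factorization. -/
def PhiH {n d : ℕ} (lam : ℂ) (m : PhaseSpace n d) : Mat d :=
  (lam • (1 : Mat d) + m.2 * m.1)⁻¹

end

end PoissonLie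

/-!
The proof rests on the Hamiltonian vector `V(α) = P(α, ·)` of a covector `α = (xᵀ, ξ)`.

*Poisson brackets.* Skew-symmetry, bilinearity and the Leibniz rule of a bracket
`{F, H} = dH (V (dF))` are formal. In the Jacobi identity the second derivatives of the functions
cancel by symmetry, so that it only has to be checked on constant covectors
(`IsPoissonHamiltonian.isPoissonBracket`). For the Sklyanin bracket this is an identity of traces,
which follows from the cyclic form `IsRMatrix.trace_cyclic` of the modified Yang-Baxter equation:
the contributions of the left and of the right derivatives cancel. On `M`, a point becomes the odd
block matrix `N = (0, v; wᵀ, 0)` and a covector the odd block matrix `a = (0, ξ; xᵀ, 0)`. With the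
grading operator `s` and the r-matrix `r = R ⊕ ρ` on even block matrices the Hamiltonian vector is
`V(a) = ([r [N, a], N] - s ((N² + λ) a + a (N² + λ))) / 2`, and the Jacobi identity is again an
identity of traces, `phaseSpace_trace_identity`. The actions of the groups enter through `[N, a]`,
whose diagonal blocks `v xᵀ - ξ wᵀ` and `wᵀ ξ - xᵀ v` pair with `X` to the values of `α` on the
infinitesimal actions of `X`.

*Momentum maps.* On the diagonal blocks of `N² + λ` the formula for `V` shows that, for both maps
`Φ`, the derivative of `Φ` along `V(α)` is `Y₊ Φ - Φ Y₋`, where `Y` is the corresponding block of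
`[N, a]` (`fderiv_PhiG_phaseVector`, `fderiv_PhiH_phaseVector`). If `J = (J₊, J₋)` factorizes `Φ`,
then `dJ (V(α)) J⁻¹ = (Z₊, Z₋)` for some `Z`, and `dΦ (V(α)) = Z₊ Φ - Φ Z₋`. The map
`Z ↦ Z₊ Φ - Φ Z₋` is injective, because the dual Lie algebra is stable under conjugation by the
dual group and meets the diagonal of the double only in zero (`eq_zero_of_rPlus_mul_eq`). Hence
`Z = Y`, and the pull-back of the one-form of `X` takes the value
`tr (X Z₊) - tr (X Z₋) = tr (X Y) = α (X_M)` on `V(α)` (`representsMomentumMap_of_hamiltonian`).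

*Local factorizations.* By the same injectivity and the inverse function theorem,
`X ↦ exp (X₊) Φ(m) exp (-X₋)` is a local chart at `Φ(m)`, which yields `J` near `m`. That `J` is
tangent to the dual group follows from the stability of the dual Lie algebra under the logarithmic
differential of the exponential, `fderiv_exp_mul_exp_neg_mem`. At `m = 0` the two maps are nonzero
scalars, hence exponentials of scalars, and these factorize.
-/

namespace PoissonLie

/-! ### Exponentials and subspaces of a Banach algebra -/

section BanachAlgebra

variable {𝔸 : Type*} [NormedRing 𝔸] [NormedAlgebra ℂ 𝔸]

/-- A curve which starts in a subspace and has its derivatives there stays in the subspace. -/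
theorem mem_of_hasDerivAt_mem [FiniteDimensional ℂ 𝔸] {p : Submodule ℂ 𝔸} {ψ ψ' : ℂ → 𝔸}
    (h0 : ψ 0 ∈ p) (hd : ∀ s, HasDerivAt ψ (ψ' s) s) (hm : ∀ s, ψ' s ∈ p) (s : ℂ) : ψ s ∈ p := by
  by_contra hs
  obtain ⟨f, hf, hp⟩ := Submodule.exists_le_ker_of_notMem hs
  let F : 𝔸 →L[ℂ] ℂ := LinearMap.toContinuousLinearMap f
  have hF : ∀ s, HasDerivAt (fun s => F (ψ s)) 0 s := fun s => by
    have h := F.hasFDerivAt.comp_hasDerivAt s (hd s)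
    have h2 : F (ψ' s) = 0 := hp (hm s)
    rwa [h2] at h
  have hc := is_const_of_deriv_eq_zero (fun s => (hF s).differentiableAt)
    (fun s => (hF s).deriv) s 0
  have h1 : F (ψ 0) = 0 := hp h0
  exact hf (hc.trans h1)

variable [CompleteSpace 𝔸]

theorem exp_mul_exp_neg_self (a : 𝔸) : NormedSpace.exp a * NormedSpace.exp (-a) = 1 := by
  let := NormedAlgebra.restrictScalars ℚ ℂ 𝔸
  rw [← NormedSpace.exp_add_of_commute (Commute.neg_right rfl), add_neg_cancel,
    NormedSpace.exp_zero]

theorem hasDerivAt_exp_smul_conj (a b : 𝔸) (t : ℂ) :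
    HasDerivAt (fun t : ℂ => NormedSpace.exp (t • b) * a * NormedSpace.exp (-(t • b)))
      (b * (NormedSpace.exp (t • b) * a * NormedSpace.exp (-(t • b))) -
        (NormedSpace.exp (t • b) * a * NormedSpace.exp (-(t • b))) * b) t := by
  have h1 := hasDerivAt_exp_smul_const' b t
  have h2 := hasDerivAt_exp_smul_const (-b) t
  simp only [smul_neg] at h2
  refine ((h1.mul_const a).mul h2).congr_deriv ?_
  noncomm_ring

/-- Conjugation by `exp b` preserves a subspace that is stable under `ad b`. -/
theorem exp_conj_mem [FiniteDimensional ℂ 𝔸] {p : Submodule ℂ 𝔸} {b : 𝔸}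
    (hb : ∀ x ∈ p, b * x - x * b ∈ p) {a : 𝔸} (ha : a ∈ p) :
    NormedSpace.exp b * a * NormedSpace.exp (-b) ∈ p := by
  let D : 𝔸 →L[ℂ] 𝔸 := ContinuousLinearMap.mul ℂ 𝔸 b - (ContinuousLinearMap.mul ℂ 𝔸).flip b
  have hD : ∀ x, D x = b * x - x * b := fun x => rfl
  -- `exp D` preserves `p`, because the power series converges and `p` is closed
  have hpow : ∀ (n : ℕ) (x : 𝔸), x ∈ p → (D ^ n) x ∈ p := by
    intro n
    induction n with
    | zero => intro x hx; simpa using hx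
    | succ n ih => intro x hx; rw [pow_succ]; exact ih _ (hD x ▸ hb x hx)
  have hcl : IsClosed (p : Set 𝔸) := p.closed_of_finiteDimensional
  have hexp : NormedSpace.exp D a ∈ p := by
    have h := (NormedSpace.exp_series_hasSum_exp' (𝕂 := ℂ) D).mapL
      (ContinuousLinearMap.apply ℂ 𝔸 a)
    refine hcl.mem_of_tendsto h (Filter.Eventually.of_forall fun s => ?_)
    exact p.sum_mem fun n _ => p.smul_mem _ (hpow n a ha)
  -- `exp (-t D) (exp (t b) a exp (-t b))` does not depend on `t`
  have hder : ∀ t : ℂ, HasDerivAt (fun t : ℂ => NormedSpace.exp (t • (-D))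
      (NormedSpace.exp (t • b) * a * NormedSpace.exp (-(t • b)))) 0 t := fun t => by
    refine ((hasDerivAt_exp_smul_const (-D) t).clm_apply
      (hasDerivAt_exp_smul_conj a b t)).congr_deriv ?_
    rw [← hD, mul_apply_eq_comp, neg_apply, map_neg]
    exact neg_add_cancel _
  have hconst := is_const_of_deriv_eq_zero (fun t => (hder t).differentiableAt)
    (fun t => (hder t).deriv) 1 0
  simp only [one_smul, zero_smul, NormedSpace.exp_zero, neg_zero, one_mul, mul_one] at hconst
  have h2 : NormedSpace.exp D (NormedSpace.exp (-D)
      (NormedSpace.exp b * a * NormedSpace.exp (-b))) =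
      NormedSpace.exp b * a * NormedSpace.exp (-b) := by
    rw [← _root_.mul_apply_eq_comp, exp_mul_exp_neg_self]; rfl
  have h3 : NormedSpace.exp ((0 : ℂ) • (-D)) a = a := by
    rw [zero_smul ℂ (-D), NormedSpace.exp_zero]; rfl
  rw [← h2, hconst, h3]
  exact hexp

/-- The differential of the exponential satisfies the derivative, in the direction `B`, of the
identity `d exp_X (X) = exp X * X`. -/
theorem fderiv_fderiv_exp (X B : 𝔸) :
    fderiv ℂ (fderiv ℂ (NormedSpace.exp : 𝔸 → 𝔸)) X X B + fderiv ℂ NormedSpace.exp X B =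
      fderiv ℂ NormedSpace.exp X B * X + NormedSpace.exp X * B := by
  have han : AnalyticAt ℂ (NormedSpace.exp : 𝔸 → 𝔸) X := NormedSpace.exp_analytic X
  have hself : ∀ Y : 𝔸, fderiv ℂ (NormedSpace.exp : 𝔸 → 𝔸) Y Y = NormedSpace.exp Y * Y := by
    intro Y
    have h1 := hasDerivAt_exp_smul_const (𝕂 := ℂ) Y 1
    have hd : DifferentiableAt ℂ (NormedSpace.exp : 𝔸 → 𝔸) ((1 : ℂ) • Y) :=
      (NormedSpace.exp_analytic _).differentiableAt
    have h2 := hd.hasFDerivAt.comp_hasDerivAt (1 : ℂ) ((hasDerivAt_id (1 : ℂ)).smul_const Y)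
    have h3 := h2.unique h1
    simpa using h3
  have hL : HasFDerivAt (fun Y : 𝔸 => fderiv ℂ (NormedSpace.exp : 𝔸 → 𝔸) Y Y)
      _ X := han.fderiv.differentiableAt.hasFDerivAt.clm_apply (hasFDerivAt_id X)
  have hR : HasFDerivAt (fun Y : 𝔸 => NormedSpace.exp Y * Y) _ X :=
    han.differentiableAt.hasFDerivAt.mul' (hasFDerivAt_id X)
  rw [funext hself] at hL
  have h := congrArg (fun T : 𝔸 →L[ℂ] 𝔸 => T B) (hL.unique hR)
  have hsymm : IsSymmSndFDerivAt ℂ (NormedSpace.exp : 𝔸 → 𝔸) X :=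
    ContDiffAt.isSymmSndFDerivAt_of_omega han.contDiffAt
  rw [hsymm X B]
  simp at h
  rw [add_comm, h, add_comm]

/-- The right logarithmic differential `d exp_A (B) * exp (-A)` of the exponential takes values in
every subspace that contains `B` and is stable under `ad A`. -/
theorem fderiv_exp_mul_exp_neg_mem [FiniteDimensional ℂ 𝔸] {p : Submodule ℂ 𝔸} {A B : 𝔸}
    (hA : ∀ x ∈ p, A * x - x * A ∈ p) (hB : B ∈ p) :
    fderiv ℂ NormedSpace.exp A B * NormedSpace.exp (-A) ∈ p := by
  have hder : ∀ s : ℂ, HasDerivAt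
      (fun s : ℂ => fderiv ℂ (NormedSpace.exp : 𝔸 → 𝔸) (s • A) (s • B) *
        NormedSpace.exp (s • (-A)))
      (NormedSpace.exp (s • A) * B * NormedSpace.exp (-(s • A))) s := by
    intro s
    have han : AnalyticAt ℂ (NormedSpace.exp : 𝔸 → 𝔸) (s • A) := NormedSpace.exp_analytic _
    have h1 := han.fderiv.differentiableAt.hasFDerivAt.comp_hasDerivAt s
      ((hasDerivAt_id s).smul_const A)
    have h2 := (h1.clm_apply ((hasDerivAt_id s).smul_const B)).mul
      (hasDerivAt_exp_smul_const' (-A) s)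
    refine h2.congr_deriv ?_
    have h3 := fderiv_fderiv_exp (s • A) B
    have h4 : fderiv ℂ (fderiv ℂ (NormedSpace.exp : 𝔸 → 𝔸)) (s • A) A (s • B) +
        fderiv ℂ (NormedSpace.exp : 𝔸 → 𝔸) (s • A) B =
        fderiv ℂ (NormedSpace.exp : 𝔸 → 𝔸) (s • A) (s • B) * A + NormedSpace.exp (s • A) * B := by
      simpa using h3
    simp only [one_smul, id, Function.comp, h4, smul_neg]
    noncomm_ring
  have h := mem_of_hasDerivAt_mem (p := p) (by simp) hder (fun s => exp_conj_mem (b := s • A)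
    (fun x hx => by
      rw [smul_mul_assoc, mul_smul_comm, ← smul_sub]
      exact p.smul_mem _ (hA x hx)) hB) 1
  simpa using h

end BanachAlgebra

/-! ### Poisson brackets from Hamiltonian vectors -/

section Hamiltonian

variable {E : Type*} [NormedAddCommGroup E] [NormedSpace ℂ E]

theorem hasDerivAt_add_smul (m u : E) : HasDerivAt (fun t : ℂ => m + t • u) u 0 := by
  have h := ((hasDerivAt_id (0 : ℂ)).smul_const u).const_add m
  rwa [one_smul] at h

/-- A bivector field on an open set `Ω`, encoded through its Hamiltonian map: `V m α` is the
tangent vector with `P_m (α, β) = β (V m α)`, and `V' m u α` is the derivative of `V · α` at `m` in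
the direction `u`. The condition `jacobi` says that the Schouten bracket of the bivector field with
itself vanishes on constant covectors. -/
structure IsPoissonHamiltonian (Ω : Set E) (V : E → Module.Dual ℂ E → E)
    (V' : E → E → Module.Dual ℂ E → E) : Prop where
  isOpen : IsOpen Ω
  analytic : ∀ m ∈ Ω, ∀ α, AnalyticAt ℂ (fun x => V x α) m
  map_add : ∀ m α β, V m (α + β) = V m α + V m β
  map_smul : ∀ m (c : ℂ) α, V m (c • α) = c • V m α
  skew : ∀ m ∈ Ω, ∀ α β : Module.Dual ℂ E, β (V m α) = -α (V m β)
  hasDerivAt : ∀ m ∈ Ω, ∀ u α, HasDerivAt (fun t : ℂ => V (m + t • u) α) (V' m u α) 0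
  jacobi : ∀ m ∈ Ω, ∀ α β γ : Module.Dual ℂ E,
    γ (V' m (V m α) β) + α (V' m (V m β) γ) + β (V' m (V m γ) α) = 0

variable {Ω : Set E} {V : E → Module.Dual ℂ E → E} {V' : E → E → Module.Dual ℂ E → E}

/-- The expansion in a basis reduces the analyticity of `x ↦ V x (δ x)` to that of `x ↦ V x α` for
constant `α`. -/
theorem IsPoissonHamiltonian.eq_sum [FiniteDimensional ℂ E] (h : IsPoissonHamiltonian Ω V V')
    (m : E) (α : Module.Dual ℂ E) :
    V m α = ∑ i, α (Module.finBasis ℂ E i) • V m ((Module.finBasis ℂ E).coord i) := by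
  let L : Module.Dual ℂ E →ₗ[ℂ] E := ⟨⟨V m, h.map_add m⟩, h.map_smul m⟩
  change L α = ∑ i, α (Module.finBasis ℂ E i) • L ((Module.finBasis ℂ E).coord i)
  conv_lhs => rw [← (Module.finBasis ℂ E).sum_dual_apply_smul_coord α]
  simp only [_root_.map_sum, _root_.map_smul]

theorem IsPoissonHamiltonian.fderiv_apply (h : IsPoissonHamiltonian Ω V V') {m : E} (hm : m ∈ Ω)
    (u : E) (α : Module.Dual ℂ E) : fderiv ℂ (fun x => V x α) m u = V' m u α := by
  have hL : HasFDerivAt (fun x => V x α) (fderiv ℂ (fun x => V x α) m) (m + (0 : ℂ) • u) := by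
    rw [zero_smul, add_zero]
    exact (h.analytic m hm α).differentiableAt.hasFDerivAt
  exact (HasFDerivAt.comp_hasDerivAt (f := fun t : ℂ => m + t • u) (0 : ℂ) hL
    (hasDerivAt_add_smul m u)).unique (h.hasDerivAt m hm u α)

/-- The product rule for the Hamiltonian vector of a variable covector `δ`. -/
theorem IsPoissonHamiltonian.exists_hasFDerivAt [FiniteDimensional ℂ E]
    (h : IsPoissonHamiltonian Ω V V') {m : E} (hm : m ∈ Ω) {δ : E → E →L[ℂ] ℂ}
    (hδ : DifferentiableAt ℂ δ m) :
    ∃ L : E →L[ℂ] E, HasFDerivAt (fun x => V x (δ x).toLinearMap) L m ∧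
      ∀ u, L u = V' m u (δ m).toLinearMap + V m (fderiv ℂ δ m u).toLinearMap := by
  have hsum : ∀ δ : E → E →L[ℂ] ℂ, DifferentiableAt ℂ δ m →
      HasFDerivAt (fun x => V x (δ x).toLinearMap) (∑ i,
        ((δ m (Module.finBasis ℂ E i)) • fderiv ℂ (fun x => V x ((Module.finBasis ℂ E).coord i)) m +
          ((fderiv ℂ δ m).flip (Module.finBasis ℂ E i)).smulRight
            (V m ((Module.finBasis ℂ E).coord i)))) m := by
    intro δ hδ
    rw [funext fun x => h.eq_sum x (δ x).toLinearMap]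
    refine HasFDerivAt.fun_sum fun i _ => ?_
    have h1 := hδ.hasFDerivAt.clm_apply (hasFDerivAt_const (Module.finBasis ℂ E i) m)
    have h2 := h1.smul
      (h.analytic m hm ((Module.finBasis ℂ E).coord i)).differentiableAt.hasFDerivAt
    refine h2.congr_fderiv ?_
    simp
  refine ⟨_, hsum δ hδ, fun u => ?_⟩
  have h1 := congrArg (fun T : E →L[ℂ] E => T u)
    (hsum (fun _ => δ m) (differentiableAt_const _)).fderiv
  simp only [h.fderiv_apply hm] at h1
  rw [h1, h.eq_sum m (fderiv ℂ δ m u).toLinearMap]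
  simp [Finset.sum_add_distrib]

/-- The Jacobiator of a bracket of functions is a sum of second derivatives, which cancel by
symmetry, and of the Schouten bracket of the bivector field with itself. -/
theorem IsPoissonHamiltonian.isPoissonBracket [FiniteDimensional ℂ E]
    (h : IsPoissonHamiltonian Ω V V')
    {B : (E → ℂ) → (E → ℂ) → E → ℂ}
    (hB : ∀ F H, ∀ m ∈ Ω, B F H m = fderiv ℂ H m (V m (fderiv ℂ F m).toLinearMap)) :
    IsPoissonBracket Ω B where
  holomorphic F H hF hH := by
    intro m hm
    have := FiniteDimensional.complete ℂ E
    have h1 : AnalyticAt ℂ (fun x => fderiv ℂ H x (V x (fderiv ℂ F x).toLinearMap)) m := by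
      have h2 : AnalyticAt ℂ (fun x => V x (fderiv ℂ F x).toLinearMap) m := by
        rw [funext fun x => h.eq_sum x (fderiv ℂ F x).toLinearMap]
        refine Finset.analyticAt_fun_sum _ fun i _ => AnalyticAt.fun_smul ?_ (h.analytic m hm _)
        exact AnalyticAt.fun_comp_of_eq (((ContinuousLinearMap.apply ℂ ℂ
          (Module.finBasis ℂ E i))).analyticAt _) (hF m hm).fderiv rfl
      exact AnalyticAt.fun_comp_of_eq
        ((ContinuousLinearMap.id ℂ (E →L[ℂ] ℂ)).analyticAt_bilinear (fderiv ℂ H m, _))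
        ((hH m hm).fderiv.prod h2) rfl
    refine h1.congr ?_
    filter_upwards [h.isOpen.mem_nhds hm] with x hx using (hB F H x hx).symm
  add_left F K H hF hK hH := by
    intro m hm
    rw [Pi.add_apply, hB _ _ m hm, hB _ _ m hm, hB _ _ m hm,
      fderiv_add (hF m hm).differentiableAt (hK m hm).differentiableAt,
      ContinuousLinearMap.toLinearMap_add, h.map_add, _root_.map_add]
  smul_left c F H hF hH := by
    intro m hm
    rw [Pi.smul_apply, hB _ _ m hm, hB _ _ m hm,
      fderiv_const_smul (hF m hm).differentiableAt,
      ContinuousLinearMap.toLinearMap_smul, h.map_smul, _root_.map_smul]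
  skew F H hF hH := by
    intro m hm
    rw [Pi.neg_apply, hB _ _ m hm, hB _ _ m hm]
    exact h.skew m hm _ _
  leibniz F K H hF hK hH := by
    intro m hm
    rw [Pi.add_apply, Pi.mul_apply, Pi.mul_apply, hB _ _ m hm, hB _ _ m hm, hB _ _ m hm,
      fderiv_mul (hF m hm).differentiableAt (hK m hm).differentiableAt,
      ContinuousLinearMap.toLinearMap_add, ContinuousLinearMap.toLinearMap_smul,
      ContinuousLinearMap.toLinearMap_smul, h.map_add, h.map_smul, h.map_smul,
      _root_.map_add, _root_.map_smul, _root_.map_smul, smul_eq_mul, smul_eq_mul]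
    ring
  jacobi F H K hF hH hK := by
    intro m hm
    have := FiniteDimensional.complete ℂ E
    -- the last term comes from moving the derivative of `dH` off `K` by skew-symmetry
    have key : ∀ F H K : E → ℂ, AnalyticOnNhd ℂ F Ω → AnalyticOnNhd ℂ H Ω →
        AnalyticOnNhd ℂ K Ω → B F (B H K) m =
          fderiv ℂ (fderiv ℂ K) m (V m (fderiv ℂ F m).toLinearMap)
              (V m (fderiv ℂ H m).toLinearMap) +
            fderiv ℂ K m (V' m (V m (fderiv ℂ F m).toLinearMap) (fderiv ℂ H m).toLinearMap) -
            fderiv ℂ (fderiv ℂ H) m (V m (fderiv ℂ F m).toLinearMap)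
              (V m (fderiv ℂ K m).toLinearMap) := by
      intro F H K hF hH hK
      obtain ⟨L, hL, hLu⟩ := h.exists_hasFDerivAt hm (hH m hm).fderiv.differentiableAt
      have h1 := (hK m hm).fderiv.differentiableAt.hasFDerivAt.clm_apply hL
      have h2 : B H K =ᶠ[nhds m] fun x => fderiv ℂ K x (V x (fderiv ℂ H x).toLinearMap) := by
        filter_upwards [h.isOpen.mem_nhds hm] with x hx using hB H K x hx
      rw [hB _ _ m hm, h2.fderiv_eq, h1.fderiv]
      simp only [add_apply, ContinuousLinearMap.comp_apply,
        ContinuousLinearMap.flip_apply, hLu, _root_.map_add]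
      have h3 := h.skew m hm
        (fderiv ℂ (fderiv ℂ H) m (V m (fderiv ℂ F m).toLinearMap)).toLinearMap
        (fderiv ℂ K m).toLinearMap
      simp only [ContinuousLinearMap.coe_coe] at h3
      rw [h3]
      ring
    have hs : ∀ F : E → ℂ, AnalyticOnNhd ℂ F Ω → ∀ u w,
        fderiv ℂ (fderiv ℂ F) m u w = fderiv ℂ (fderiv ℂ F) m w u := fun F hF u w =>
      (ContDiffAt.isSymmSndFDerivAt_of_omega (hF m hm).contDiffAt) u w
    rw [Pi.add_apply, Pi.add_apply, key F H K hF hH hK, key H K F hH hK hF, key K F H hK hF hH,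
      hs F hF (V m (fderiv ℂ H m).toLinearMap), hs K hK (V m (fderiv ℂ F m).toLinearMap),
      hs H hH (V m (fderiv ℂ F m).toLinearMap)]
    have := h.jacobi m hm (fderiv ℂ F m).toLinearMap (fderiv ℂ H m).toLinearMap
      (fderiv ℂ K m).toLinearMap
    simp only [ContinuousLinearMap.coe_coe] at this
    rw [Pi.zero_apply]
    linear_combination this

end Hamiltonian

/-! ### Calculus of matrix products -/

section MatrixCalculus

variable {l m n : Type*} [Fintype l] [Fintype m] [Fintype n]
  {E : Type*} [NormedAddCommGroup E] [NormedSpace ℂ E]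

/-- Multiplication of rectangular matrices as a continuous bilinear map. -/
noncomputable def matMulL (l m n : Type*) [Fintype l] [Fintype m] [Fintype n] :
    Matrix l m ℂ →L[ℂ] Matrix m n ℂ →L[ℂ] Matrix l n ℂ :=
  (LinearMap.mk₂ ℂ (fun (A : Matrix l m ℂ) (B : Matrix m n ℂ) => A * B)
    Matrix.add_mul (fun r A B => Matrix.smul_mul r A B) Matrix.mul_add
    (fun r A B => Matrix.mul_smul A r B)).mkContinuous₂ 1 fun A B => by
      rw [one_mul]; exact Matrix.linfty_opNorm_mul A B

theorem analyticAt_matrix_mul {f : E → Matrix l m ℂ} {g : E → Matrix m n ℂ}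
    {x : E} (hf : AnalyticAt ℂ f x) (hg : AnalyticAt ℂ g x) :
    AnalyticAt ℂ (fun x => f x * g x) x :=
  AnalyticAt.fun_comp_of_eq ((matMulL l m n).analyticAt_bilinear (f x, g x)) (hf.prod hg) rfl

theorem hasDerivAt_matrix_mul {f : ℂ → Matrix l m ℂ}
    {g : ℂ → Matrix m n ℂ} {f' g' t} (hf : HasDerivAt f f' t) (hg : HasDerivAt g g' t) :
    HasDerivAt (fun x => f x * g x) (f' * g t + f t * g') t := by
  refine ((matMulL l m n).hasDerivAt_of_bilinear (fun _ => hf) fun _ => hg).congr_deriv ?_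
  exact add_comm _ _

theorem hasFDerivAt_matrix_mul {f : E → Matrix l m ℂ} {g : E → Matrix m n ℂ}
    {f' : E →L[ℂ] Matrix l m ℂ} {g' : E →L[ℂ] Matrix m n ℂ} {x : E}
    (hf : HasFDerivAt f f' x) (hg : HasFDerivAt g g' x) :
    ∃ L : E →L[ℂ] Matrix l n ℂ, HasFDerivAt (fun x => f x * g x) L x ∧
      ∀ u, L u = f' u * g x + f x * g' u :=
  ⟨_, (matMulL l m n).hasFDerivAt_of_bilinear hf hg, fun _ => add_comm _ _⟩

theorem analyticAt_linearMap_comp {F G : Type*} [NormedAddCommGroup F] [NormedSpace ℂ F]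
    [FiniteDimensional ℂ F] [NormedAddCommGroup G] [NormedSpace ℂ G] (L : F →ₗ[ℂ] G) {f : E → F}
    {x : E} (hf : AnalyticAt ℂ f x) : AnalyticAt ℂ (fun x => L (f x)) x :=
  AnalyticAt.fun_comp_of_eq (L.toContinuousLinearMap.analyticAt (f x)) hf rfl

theorem hasDerivAt_linearMap_comp {F G : Type*} [NormedAddCommGroup F] [NormedSpace ℂ F]
    [FiniteDimensional ℂ F] [NormedAddCommGroup G] [NormedSpace ℂ G] (L : F →ₗ[ℂ] G) {f : ℂ → F}
    {f' : F} {t : ℂ} (hf : HasDerivAt f f' t) : HasDerivAt (fun x => L (f x)) (L f') t :=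
  L.toContinuousLinearMap.hasFDerivAt.comp_hasDerivAt t hf

end MatrixCalculus

/-! ### Trace identities behind the Jacobi identities -/

section Trace

open Matrix

variable {ι : Type*} [Fintype ι] [DecidableEq ι]

/-- The algebraic form of the Jacobi identity for the Sklyanin bracket. Here `pa`, `pb`, `pc` are
the images under the r-matrix of the left derivatives `g a`, `g b`, `g c`, and `qa`, `qb`, `qc`
those of the right derivatives `a g`, `b g`, `c g`. -/
theorem sklyanin_trace_identity {κ : ℂ} {g a b c pa pb pc qa qb qc : Matrix ι ι ℂ}
    (hp : (g * a * ⁅pb, pc⁆).trace + (g * b * ⁅pc, pa⁆).trace + (g * c * ⁅pa, pb⁆).trace =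
      κ * (g * a * ⁅g * b, g * c⁆).trace)
    (hq : (a * g * ⁅qb, qc⁆).trace + (b * g * ⁅qc, qa⁆).trace + (c * g * ⁅qa, qb⁆).trace =
      κ * (a * g * ⁅b * g, c * g⁆).trace) :
    ((g * qa - pa * g) * (qb * c - qc * b + b * pc - c * pb)).trace +
      ((g * qb - pb * g) * (qc * a - qa * c + c * pa - a * pc)).trace +
      ((g * qc - pc * g) * (qa * b - qb * a + a * pb - b * pa)).trace = 0 := by
  -- rotate every word so that it begins with `a`, `b` or `c`
  have hg : ∀ w, (g * w).trace = (w * g).trace := fun w => trace_mul_comm _ _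
  have h1 : ∀ w, (pa * w).trace = (w * pa).trace := fun w => trace_mul_comm _ _
  have h2 : ∀ w, (pb * w).trace = (w * pb).trace := fun w => trace_mul_comm _ _
  have h3 : ∀ w, (pc * w).trace = (w * pc).trace := fun w => trace_mul_comm _ _
  have h4 : ∀ w, (qa * w).trace = (w * qa).trace := fun w => trace_mul_comm _ _
  have h5 : ∀ w, (qb * w).trace = (w * qb).trace := fun w => trace_mul_comm _ _
  have h6 : ∀ w, (qc * w).trace = (w * qc).trace := fun w => trace_mul_comm _ _
  simp only [Ring.lie_def, mul_sub, sub_mul, mul_add, mul_assoc, trace_add, trace_sub,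
    hg, h1, h2, h3, h4, h5, h6] at hp hq ⊢
  linear_combination hq - hp

/-- The algebraic form of the Jacobi identity on the phase space. The matrices `N`, `a`, `b`, `c`
are odd with respect to the grading `s`, and `ra`, `rb`, `rc`, the images under the r-matrix of
`[N, a]`, `[N, b]`, `[N, c]`, are even. -/
theorem phaseSpace_trace_identity {lam : ℂ} {s N a b c ra rb rc : Matrix ι ι ℂ} (hs : s * s = 1)
    (hN : N * s = -(s * N)) (ha : a * s = -(s * a)) (hb : b * s = -(s * b))
    (hc : c * s = -(s * c)) (hra : ra * s = s * ra) (hrb : rb * s = s * rb) (hrc : rc * s = s * rc)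
    (hcyc : ((N * a - a * N) * ⁅rb, rc⁆).trace + ((N * b - b * N) * ⁅rc, ra⁆).trace +
      ((N * c - c * N) * ⁅ra, rb⁆).trace =
        -((N * a - a * N) * ⁅N * b - b * N, N * c - c * N⁆).trace) :
    (((ra * N - N * ra) - s * ((N * N + lam • 1) * a + a * (N * N + lam • 1))) *
        (((c * rb - rb * c) - (b * rc - rc * b)) - s * ((b * c - c * b) * N - N * (b * c - c * b)))
          ).trace +
      (((rb * N - N * rb) - s * ((N * N + lam • 1) * b + b * (N * N + lam • 1))) *
        (((a * rc - rc * a) - (c * ra - ra * c)) - s * ((c * a - a * c) * N - N * (c * a - a * c)))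
          ).trace +
      (((rc * N - N * rc) - s * ((N * N + lam • 1) * c + c * (N * N + lam • 1))) *
        (((b * ra - ra * b) - (a * rb - rb * a)) - s * ((a * b - b * a) * N - N * (a * b - b * a)))
          ).trace = 0 := by
  have hN2 : ∀ w, N * (s * w) = -(s * (N * w)) := fun w => by
    rw [← mul_assoc, hN, neg_mul, mul_assoc]
  have ha2 : ∀ w, a * (s * w) = -(s * (a * w)) := fun w => by
    rw [← mul_assoc, ha, neg_mul, mul_assoc]
  have hb2 : ∀ w, b * (s * w) = -(s * (b * w)) := fun w => by
    rw [← mul_assoc, hb, neg_mul, mul_assoc]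
  have hc2 : ∀ w, c * (s * w) = -(s * (c * w)) := fun w => by
    rw [← mul_assoc, hc, neg_mul, mul_assoc]
  have hra2 : ∀ w, ra * (s * w) = s * (ra * w) := fun w => by rw [← mul_assoc, hra, mul_assoc]
  have hrb2 : ∀ w, rb * (s * w) = s * (rb * w) := fun w => by rw [← mul_assoc, hrb, mul_assoc]
  have hrc2 : ∀ w, rc * (s * w) = s * (rc * w) := fun w => by rw [← mul_assoc, hrc, mul_assoc]
  have hs2 : ∀ w, s * (s * w) = w := fun w => by rw [← mul_assoc, hs, one_mul]
  have tN : ∀ w, (N * w).trace = (w * N).trace := fun w => trace_mul_comm _ _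
  have ta : ∀ w, (a * w).trace = (w * a).trace := fun w => trace_mul_comm _ _
  have tb : ∀ w, (b * w).trace = (w * b).trace := fun w => trace_mul_comm _ _
  have tc : ∀ w, (c * w).trace = (w * c).trace := fun w => trace_mul_comm _ _
  have tra : ∀ w, (ra * w).trace = (w * ra).trace := fun w => trace_mul_comm _ _
  have trb : ∀ w, (rb * w).trace = (w * rb).trace := fun w => trace_mul_comm _ _
  have trc : ∀ w, (rc * w).trace = (w * rc).trace := fun w => trace_mul_comm _ _
  -- the cyclic property of the trace for odd matrices, in the presence of the grading
  have ts : ∀ x : Matrix ι ι ℂ, x * s = -(s * x) → ∀ w,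
      (s * (x * w)).trace = -(s * (w * x)).trace := fun x hx w => by
    rw [← mul_assoc s w x, trace_mul_comm (s * w) x, ← mul_assoc x, hx, neg_mul, trace_neg,
      neg_neg, mul_assoc]
  have tsN := ts N hN
  have tsa := ts a ha
  have tsb := ts b hb
  have tsc := ts c hc
  -- terms of degree two in the r-matrix
  have h2 : ((ra * N - N * ra) * ((c * rb - rb * c) - (b * rc - rc * b))).trace +
      ((rb * N - N * rb) * ((a * rc - rc * a) - (c * ra - ra * c))).trace +
      ((rc * N - N * rc) * ((b * ra - ra * b) - (a * rb - rb * a))).trace =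
        ((N * a - a * N) * ⁅N * b - b * N, N * c - c * N⁆).trace := by
    rw [← neg_eq_iff_eq_neg.mpr hcyc]
    simp only [Ring.lie_def, mul_sub, sub_mul, mul_assoc, trace_sub, ta, tb, tc, tra, trb, trc]
    ring
  -- terms of degree one
  have h1 : ((ra * N - N * ra) * (s * ((b * c - c * b) * N - N * (b * c - c * b)))).trace +
      ((rb * N - N * rb) * (s * ((c * a - a * c) * N - N * (c * a - a * c)))).trace +
      ((rc * N - N * rc) * (s * ((a * b - b * a) * N - N * (a * b - b * a)))).trace +
      (s * ((N * N + lam • 1) * a + a * (N * N + lam • 1)) *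
        ((c * rb - rb * c) - (b * rc - rc * b))).trace +
      (s * ((N * N + lam • 1) * b + b * (N * N + lam • 1)) *
        ((a * rc - rc * a) - (c * ra - ra * c))).trace +
      (s * ((N * N + lam • 1) * c + c * (N * N + lam • 1)) *
        ((b * ra - ra * b) - (a * rb - rb * a))).trace = 0 := by
    simp only [mul_sub, sub_mul, mul_add, add_mul, mul_assoc, trace_sub, trace_add, trace_neg,
      smul_mul_assoc, mul_smul_comm, trace_smul, one_mul, mul_one, smul_eq_mul, hN2, hra2, hrb2,
      hrc2, mul_neg, tsN, tsa, tsb, tsc]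
    ring
  -- terms of degree zero
  have h0 : (s * ((N * N + lam • 1) * a + a * (N * N + lam • 1)) *
        (s * ((b * c - c * b) * N - N * (b * c - c * b)))).trace +
      (s * ((N * N + lam • 1) * b + b * (N * N + lam • 1)) *
        (s * ((c * a - a * c) * N - N * (c * a - a * c)))).trace +
      (s * ((N * N + lam • 1) * c + c * (N * N + lam • 1)) *
        (s * ((a * b - b * a) * N - N * (a * b - b * a)))).trace =
        -((N * a - a * N) * ⁅N * b - b * N, N * c - c * N⁆).trace := by
    simp only [Ring.lie_def, mul_sub, sub_mul, mul_add, add_mul, mul_assoc, trace_sub, trace_add,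
      trace_neg, smul_mul_assoc, mul_smul_comm, trace_smul, one_mul, mul_one, smul_eq_mul, hN2, ha2,
      hb2, hc2, hs2, mul_neg, neg_neg, tN, tb, tc, smul_neg]
    ring
  have hexpand : ∀ P Q S D : Matrix ι ι ℂ, ((P - Q) * (S - D)).trace =
      (P * S).trace - (P * D).trace - (Q * S).trace + (Q * D).trace := fun P Q S D => by
    simp only [sub_mul, mul_sub, trace_sub]
    ring
  rw [hexpand (ra * N - N * ra), hexpand (rb * N - N * rb), hexpand (rc * N - N * rc)]
  linear_combination h2 - h1 + h0

end Trace

/-! ### The Sklyanin bracket -/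

open Matrix

/-- The cyclic sum of `tr (X [R Y, R Z])` is minus the invariant three-form: this is the modified
Yang-Baxter equation paired with `X`, after skew-symmetry has moved `R` to `X`. -/
theorem IsRMatrix.trace_cyclic {k : ℕ} {R : Mat k →ₗ[ℂ] Mat k} (hR : IsRMatrix R) (X Y Z : Mat k) :
    (X * ⁅R Y, R Z⁆).trace + (Y * ⁅R Z, R X⁆).trace + (Z * ⁅R X, R Y⁆).trace =
      -(X * ⁅Y, Z⁆).trace := by
  have h := congrArg (fun A => (X * A).trace) (hR.yangBaxter Y Z)
  simp only [mul_add, mul_sub, trace_add, trace_sub, hR.skew, mul_zero, trace_zero] at h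
  have h1 : ∀ A B C : Mat k, (A * ⁅B, C⁆).trace = (B * ⁅C, A⁆).trace := fun A B C => by
    simp only [Ring.lie_def, mul_sub, trace_sub]
    rw [trace_mul_comm A, trace_mul_comm A (C * B), mul_assoc, mul_assoc, trace_mul_comm C,
      mul_assoc]
  rw [h1 Z (R X), ← h1 (R X) Y]
  linear_combination h

/-- The tangent vector that represents the functional `{F, ·}` of the Sklyanin bracket, as a
function of the differential `α` of `F` at `g`. -/
def sklyaninVector {k : ℕ} (R : Mat k →ₗ[ℂ] Mat k) (g : Mat k) (α : Module.Dual ℂ (Mat k)) :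
    Mat k :=
  g * R (traceDual α * g) - R (g * traceDual α) * g

/-- The derivative of `sklyaninVector R g α` with respect to `g` in the direction `u`. -/
def sklyaninVectorDeriv {k : ℕ} (R : Mat k →ₗ[ℂ] Mat k) (g u : Mat k)
    (α : Module.Dual ℂ (Mat k)) : Mat k :=
  (u * R (traceDual α * g) + g * R (traceDual α * u)) -
    (R (u * traceDual α) * g + R (g * traceDual α) * u)

theorem traceDual_add {a b : ℕ} (φ ψ : Module.Dual ℂ (Matrix (Fin a) (Fin b) ℂ)) :
    traceDual (φ + ψ) = traceDual φ + traceDual ψ := rfl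

theorem traceDual_smul {a b : ℕ} (r : ℂ) (φ : Module.Dual ℂ (Matrix (Fin a) (Fin b) ℂ)) :
    traceDual (r • φ) = r • traceDual φ := rfl

theorem traceDual_eq {a b : ℕ} {φ : Module.Dual ℂ (Matrix (Fin a) (Fin b) ℂ)}
    {B : Matrix (Fin b) (Fin a) ℂ} (h : ∀ A, φ A = (B * A).trace) : traceDual φ = B := by
  ext j i
  simp [traceDual, h, trace_mul_single]

theorem leftDeriv_eq {k : ℕ} (F : Mat k → ℂ) (g : Mat k) :
    leftDeriv F g = g * traceDual (fderiv ℂ F g).toLinearMap := by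
  refine traceDual_eq fun A => ?_
  rw [mul_assoc, trace_mul_comm, mul_assoc, trace_traceDual_mul]
  rfl

theorem rightDeriv_eq {k : ℕ} (F : Mat k → ℂ) (g : Mat k) :
    rightDeriv F g = traceDual (fderiv ℂ F g).toLinearMap * g := by
  refine traceDual_eq fun A => ?_
  rw [mul_assoc, trace_traceDual_mul]
  rfl

/-- The Sklyanin bivector field on `GL(k, ℂ)` is Poisson for each skew-symmetric `R` whose cyclic
sum of `tr (X [R Y, R Z])` is a multiple of the invariant three-form; the contributions of the
left and of the right derivatives to the Jacobi identity then cancel. -/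
theorem isPoissonHamiltonian_sklyanin {k : ℕ} {R : Mat k →ₗ[ℂ] Mat k} {κ : ℂ}
    (hskew : ∀ X Y : Mat k, (X * R Y).trace = -(R X * Y).trace)
    (hcyc : ∀ X Y Z : Mat k,
      (X * ⁅R Y, R Z⁆).trace + (Y * ⁅R Z, R X⁆).trace + (Z * ⁅R X, R Y⁆).trace =
        κ * (X * ⁅Y, Z⁆).trace) :
    IsPoissonHamiltonian (glSet k) (sklyaninVector R) (sklyaninVectorDeriv R) where
  isOpen := by
    have h : glSet k = {g | g.det ≠ 0} := by
      ext g; simp [glSet, isUnit_iff_isUnit_det]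
    rw [h]
    exact isOpen_ne_fun (Continuous.matrix_det continuous_id) continuous_const
  analytic g _ α := by
    have h0 : AnalyticAt ℂ (fun x : Mat k => x) g := analyticAt_id
    have h1 : AnalyticAt ℂ (fun _ : Mat k => traceDual α) g := analyticAt_const
    exact (analyticAt_matrix_mul h0
      (analyticAt_linearMap_comp R (analyticAt_matrix_mul h1 h0))).sub
      (analyticAt_matrix_mul (analyticAt_linearMap_comp R (analyticAt_matrix_mul h0 h1)) h0)
  map_add m α β := by
    have h := traceDual_add α β
    change sklyaninVector R m (α + β) = sklyaninVector R m α + sklyaninVector R m β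
    simp only [sklyaninVector, h, add_mul, mul_add, map_add]
    abel
  map_smul m c α := by
    have h := traceDual_smul c α
    change sklyaninVector R m (c • α) = c • sklyaninVector R m α
    simp only [sklyaninVector, h, Matrix.smul_mul, Matrix.mul_smul, map_smul, smul_sub]
  skew g _ α β := by
    rw [← trace_traceDual_mul α, ← trace_traceDual_mul β]
    set a := traceDual α with ha
    set b := traceDual β with hb
    have h2 := hskew (b * g) (a * g)
    have h4 := hskew (g * b) (g * a)
    have hg : ∀ w, (g * w).trace = (w * g).trace := fun w => trace_mul_comm _ _
    have hr : ∀ x w, (R x * w).trace = (w * R x).trace := fun x w => trace_mul_comm _ _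
    simp only [sklyaninVector, ← ha, ← hb, mul_sub, trace_sub, mul_assoc, hg, hr] at h2 h4 ⊢
    linear_combination h2 - h4
  hasDerivAt m _ u α := by
    have h0 := hasDerivAt_add_smul m u
    have h1 := hasDerivAt_const (0 : ℂ) (traceDual α)
    have h2 := (hasDerivAt_matrix_mul h0 (hasDerivAt_linearMap_comp R
      (hasDerivAt_matrix_mul h1 h0))).sub (hasDerivAt_matrix_mul (hasDerivAt_linearMap_comp R
      (hasDerivAt_matrix_mul h0 h1)) h0)
    refine h2.congr_deriv ?_
    simp [sklyaninVectorDeriv]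
  jacobi g _ α β γ := by
    have h2 : ∀ (u : Mat k) (β γ : Module.Dual ℂ (Mat k)), γ (sklyaninVectorDeriv R g u β) =
        (u * (R (traceDual β * g) * traceDual γ - R (traceDual γ * g) * traceDual β +
          traceDual β * R (g * traceDual γ) - traceDual γ * R (g * traceDual β))).trace := by
      intro u β γ
      rw [← trace_traceDual_mul γ]
      set b := traceDual β
      set c := traceDual γ
      have h3 := hskew (c * g) (b * u)
      have h4 := hskew (g * c) (u * b)
      have hc : ∀ w, (c * w).trace = (w * c).trace := fun w => trace_mul_comm _ _
      have hb : ∀ w, (b * w).trace = (w * b).trace := fun w => trace_mul_comm _ _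
      have hg : ∀ w, (g * w).trace = (w * g).trace := fun w => trace_mul_comm _ _
      have hu : ∀ w, (u * w).trace = (w * u).trace := fun w => trace_mul_comm _ _
      simp only [sklyaninVectorDeriv, mul_sub, mul_add, trace_add, trace_sub, mul_assoc,
        hb, hc, hg, hu] at h3 h4 ⊢
      linear_combination h3 - h4
    rw [h2, h2, h2]
    exact sklyanin_trace_identity (hcyc _ _ _) (hcyc _ _ _)

theorem IsRMatrix.smul_skew {k : ℕ} {R : Mat k →ₗ[ℂ] Mat k} (hR : IsRMatrix R) (r : ℂ)
    (X Y : Mat k) : (X * (r • R) Y).trace = -((r • R) X * Y).trace := by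
  simp [hR.skew]

theorem IsRMatrix.smul_trace_cyclic {k : ℕ} {R : Mat k →ₗ[ℂ] Mat k} (hR : IsRMatrix R) (r : ℂ)
    (X Y Z : Mat k) :
    (X * ⁅(r • R) Y, (r • R) Z⁆).trace + (Y * ⁅(r • R) Z, (r • R) X⁆).trace +
      (Z * ⁅(r • R) X, (r • R) Y⁆).trace = -r ^ 2 * (X * ⁅Y, Z⁆).trace := by
  have h := hR.trace_cyclic X Y Z
  simp only [Ring.lie_def, LinearMap.smul_apply, smul_mul_assoc, mul_smul_comm, smul_smul, mul_sub,
    trace_sub, trace_smul, smul_eq_mul] at h ⊢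
  linear_combination r ^ 2 * h

theorem traceDual_fderiv_comp_mulRight {k : ℕ} {F : Mat k → ℂ} {g h : Mat k}
    (hF : DifferentiableAt ℂ F (g * h)) :
    traceDual (fderiv ℂ (fun x => F (x * h)) g).toLinearMap =
      h * traceDual (fderiv ℂ F (g * h)).toLinearMap := by
  have h1 : HasFDerivAt (fun x => F (x * h))
      ((fderiv ℂ F (g * h)).comp (LinearMap.mulRight ℂ h).toContinuousLinearMap) g :=
    HasFDerivAt.comp (f := fun x : Mat k => x * h) g hF.hasFDerivAt
      (LinearMap.mulRight ℂ h).toContinuousLinearMap.hasFDerivAt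
  refine traceDual_eq fun A => ?_
  rw [h1.fderiv, mul_assoc, trace_mul_comm, mul_assoc, trace_traceDual_mul]
  rfl

theorem traceDual_fderiv_comp_mulLeft {k : ℕ} {F : Mat k → ℂ} {g h : Mat k}
    (hF : DifferentiableAt ℂ F (g * h)) :
    traceDual (fderiv ℂ (fun x => F (g * x)) h).toLinearMap =
      traceDual (fderiv ℂ F (g * h)).toLinearMap * g := by
  have h1 : HasFDerivAt (fun x => F (g * x))
      ((fderiv ℂ F (g * h)).comp (LinearMap.mulLeft ℂ g).toContinuousLinearMap) h :=
    HasFDerivAt.comp (f := fun x : Mat k => g * x) h hF.hasFDerivAt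
      (LinearMap.mulLeft ℂ g).toContinuousLinearMap.hasFDerivAt
  refine traceDual_eq fun A => ?_
  rw [h1.fderiv, mul_assoc, trace_traceDual_mul]
  rfl

/-- Every multiple of a factorizable r-matrix makes `GL(k, ℂ)` a Poisson Lie group with the Sklyanin
bracket. -/
theorem IsRMatrix.isPoissonLieGroup {k : ℕ} {R : Mat k →ₗ[ℂ] Mat k} (hR : IsRMatrix R) (r : ℂ) :
    IsPoissonLieGroup (sklyanin (r • R)) where
  poisson := by
    refine (isPoissonHamiltonian_sklyanin (hR.smul_skew r)
      (hR.smul_trace_cyclic r)).isPoissonBracket fun F H g _ => ?_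
    rw [sklyanin, leftDeriv_eq, rightDeriv_eq, leftDeriv_eq, rightDeriv_eq]
    change _ = (fderiv ℂ H g).toLinearMap (sklyaninVector (r • R) g (fderiv ℂ F g).toLinearMap)
    rw [← trace_traceDual_mul (fderiv ℂ H g).toLinearMap, sklyaninVector]
    set a := traceDual (fderiv ℂ F g).toLinearMap
    set b := traceDual (fderiv ℂ H g).toLinearMap
    have h1 := hR.smul_skew r (g * a) (g * b)
    have h2 := hR.smul_skew r (a * g) (b * g)
    have hb : ∀ w, (b * w).trace = (w * b).trace := fun w => trace_mul_comm _ _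
    have hg : ∀ w, (g * w).trace = (w * g).trace := fun w => trace_mul_comm _ _
    rw [h1, h2, mul_sub, trace_sub, hb, mul_assoc, hg]
    simp only [mul_assoc, hb]
    ring
  multiplicative F H hF hH g₁ h₁ g₂ h₂ := by
    have hF' := (hF (g₁ * g₂) (IsUnit.mul h₁ h₂)).differentiableAt
    have hH' := (hH (g₁ * g₂) (IsUnit.mul h₁ h₂)).differentiableAt
    simp only [sklyanin, leftDeriv_eq, rightDeriv_eq, traceDual_fderiv_comp_mulRight hF',
      traceDual_fderiv_comp_mulRight hH', traceDual_fderiv_comp_mulLeft hF',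
      traceDual_fderiv_comp_mulLeft hH', mul_assoc]
    ring

/-! ### The phase space as odd block matrices -/

section Block

variable {n d : ℕ}

/-- The pair `(v, wᵀ)` as the odd block matrix `(0, v; wᵀ, 0)`. -/
def oddBlock : PhaseSpace n d →ₗ[ℂ] Matrix (Fin n ⊕ Fin d) (Fin n ⊕ Fin d) ℂ where
  toFun m := fromBlocks 0 m.1 m.2 0
  map_add' m m' := by simp [fromBlocks_add]
  map_smul' r m := by simp [fromBlocks_smul]

/-- The odd part `(X₁₂, X₂₁)` of a block matrix. -/
def oddPart : Matrix (Fin n ⊕ Fin d) (Fin n ⊕ Fin d) ℂ →ₗ[ℂ] PhaseSpace n d where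
  toFun X := (X.toBlocks₁₂, X.toBlocks₂₁)
  map_add' _ _ := rfl
  map_smul' _ _ := rfl

theorem oddBlock_apply (m : PhaseSpace n d) : oddBlock m = fromBlocks 0 m.1 m.2 0 := rfl

theorem oddPart_fromBlocks (A : Mat n) (B : Matrix (Fin n) (Fin d) ℂ)
    (C : Matrix (Fin d) (Fin n) ℂ) (D : Mat d) : oddPart (fromBlocks A B C D) = (B, C) := by
  change ((fromBlocks A B C D).toBlocks₁₂, (fromBlocks A B C D).toBlocks₂₁) = _
  rw [toBlocks_fromBlocks₁₂, toBlocks_fromBlocks₂₁]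

/-- The odd block matrix of a covector `(xᵀ, ξ)`. -/
def covBlock (α : Module.Dual ℂ (PhaseSpace n d)) : Matrix (Fin n ⊕ Fin d) (Fin n ⊕ Fin d) ℂ :=
  oddBlock (covXi α, covX α)

/-- The grading operator of block matrices. -/
def grading (n d : ℕ) : Matrix (Fin n ⊕ Fin d) (Fin n ⊕ Fin d) ℂ := fromBlocks 1 0 0 (-1)

/-- The r-matrix `R ⊕ ρ` on the block diagonal matrices, extended by zero to block matrices. -/
def blockR (R : Mat n →ₗ[ℂ] Mat n) (ρ : Mat d →ₗ[ℂ] Mat d) :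
    Matrix (Fin n ⊕ Fin d) (Fin n ⊕ Fin d) ℂ →ₗ[ℂ] Matrix (Fin n ⊕ Fin d) (Fin n ⊕ Fin d) ℂ where
  toFun X := fromBlocks (R X.toBlocks₁₁) 0 0 (ρ X.toBlocks₂₂)
  map_add' X Y := by
    have h1 : (X + Y).toBlocks₁₁ = X.toBlocks₁₁ + Y.toBlocks₁₁ := rfl
    have h2 : (X + Y).toBlocks₂₂ = X.toBlocks₂₂ + Y.toBlocks₂₂ := rfl
    simp [fromBlocks_add, h1, h2]
  map_smul' r X := by
    have h1 : (r • X).toBlocks₁₁ = r • X.toBlocks₁₁ := rfl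
    have h2 : (r • X).toBlocks₂₂ = r • X.toBlocks₂₂ := rfl
    simp [fromBlocks_smul, h1, h2]

theorem trace_fromBlocks (A : Mat n) (B : Matrix (Fin n) (Fin d) ℂ)
    (C : Matrix (Fin d) (Fin n) ℂ) (D : Mat d) :
    (fromBlocks A B C D).trace = A.trace + D.trace := by
  simp [trace, Fintype.sum_sum_type]

theorem grading_mul_self : grading n d * grading n d = 1 := by
  simp [grading, fromBlocks_multiply]

theorem oddBlock_mul_grading (m : PhaseSpace n d) :
    oddBlock m * grading n d = -(grading n d * oddBlock m) := by
  simp [grading, oddBlock, fromBlocks_multiply, fromBlocks_neg]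

theorem covBlock_mul_grading (α : Module.Dual ℂ (PhaseSpace n d)) :
    covBlock α * grading n d = -(grading n d * covBlock α) := oddBlock_mul_grading _

theorem blockR_mul_grading (R : Mat n →ₗ[ℂ] Mat n) (ρ : Mat d →ₗ[ℂ] Mat d)
    (X : Matrix (Fin n ⊕ Fin d) (Fin n ⊕ Fin d) ℂ) :
    blockR R ρ X * grading n d = grading n d * blockR R ρ X := by
  simp [grading, blockR, fromBlocks_multiply]

theorem oddBlock_oddPart {X : Matrix (Fin n ⊕ Fin d) (Fin n ⊕ Fin d) ℂ}
    (hX : X * grading n d = -(grading n d * X)) : oddBlock (oddPart X) = X := by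
  rw [← fromBlocks_toBlocks X] at hX ⊢
  simp only [grading, fromBlocks_multiply, fromBlocks_neg, fromBlocks_inj, Matrix.mul_one,
    Matrix.mul_zero, add_zero, Matrix.one_mul, Matrix.zero_mul, zero_add, Matrix.mul_neg,
    Matrix.neg_mul, neg_neg] at hX
  obtain ⟨h1, -, -, h2⟩ := hX
  have h3 : X.toBlocks₁₁ = 0 := ext fun i j => self_eq_neg.mp (congrFun (congrFun h1 i) j)
  have h4 : X.toBlocks₂₂ = 0 := ext fun i j => neg_eq_self.mp (congrFun (congrFun h2 i) j)
  rw [h3, h4, oddPart_fromBlocks, oddBlock_apply]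

theorem trace_covBlock_mul (α : Module.Dual ℂ (PhaseSpace n d))
    (X : Matrix (Fin n ⊕ Fin d) (Fin n ⊕ Fin d) ℂ) :
    (covBlock α * X).trace = α (oddPart X) := by
  have h : α (oddPart X) = _ := trace_cov α X.toBlocks₁₂ X.toBlocks₂₁
  rw [h]
  conv_lhs => rw [← fromBlocks_toBlocks X]
  simp [covBlock, oddBlock, fromBlocks_multiply, trace_fromBlocks,
    trace_mul_comm (covXi α), add_comm]

theorem blockR_skew {R : Mat n →ₗ[ℂ] Mat n} (hR : IsRMatrix R) {ρ : Mat d →ₗ[ℂ] Mat d}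
    (hρ : IsRMatrix ρ) (X Y : Matrix (Fin n ⊕ Fin d) (Fin n ⊕ Fin d) ℂ) :
    (X * blockR R ρ Y).trace = -(blockR R ρ X * Y).trace := by
  rw [← fromBlocks_toBlocks X, ← fromBlocks_toBlocks Y]
  simp [blockR, fromBlocks_multiply, trace_fromBlocks, hR.skew, hρ.skew, add_comm]

theorem blockR_trace_cyclic {R : Mat n →ₗ[ℂ] Mat n} (hR : IsRMatrix R) {ρ : Mat d →ₗ[ℂ] Mat d}
    (hρ : IsRMatrix ρ) (A B C : Mat n) (A' B' C' : Mat d) :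
    (fromBlocks A 0 0 A' * ⁅blockR R ρ (fromBlocks B 0 0 B'),
        blockR R ρ (fromBlocks C 0 0 C')⁆).trace +
      (fromBlocks B 0 0 B' * ⁅blockR R ρ (fromBlocks C 0 0 C'),
        blockR R ρ (fromBlocks A 0 0 A')⁆).trace +
      (fromBlocks C 0 0 C' * ⁅blockR R ρ (fromBlocks A 0 0 A'),
        blockR R ρ (fromBlocks B 0 0 B')⁆).trace =
      -(fromBlocks A 0 0 A' * ⁅fromBlocks B 0 0 B', fromBlocks C 0 0 C'⁆).trace := by
  have h1 := hR.trace_cyclic A B C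
  have h2 := hρ.trace_cyclic A' B' C'
  simp only [Ring.lie_def, mul_sub, trace_sub] at h1 h2 ⊢
  simp [blockR, fromBlocks_multiply, trace_fromBlocks]
  linear_combination h1 + h2

/-- For a point `(v, wᵀ)` and a covector, given as the pair `(ξ, xᵀ)`, the diagonal blocks are
`v xᵀ - ξ wᵀ` and `wᵀ ξ - xᵀ v`. -/
theorem oddBlock_commutator (m m' : PhaseSpace n d) :
    oddBlock m * oddBlock m' - oddBlock m' * oddBlock m =
      fromBlocks (m.1 * m'.2 - m'.1 * m.2) 0 0 (m.2 * m'.1 - m'.2 * m.1) := by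
  simp [oddBlock, fromBlocks_multiply, sub_eq_add_neg, fromBlocks_neg, fromBlocks_add]

end Block

/-! ### The Poisson bracket on the phase space -/

section PhaseSpacePoisson

variable {n d : ℕ} (R : Mat n →ₗ[ℂ] Mat n) (ρ : Mat d →ₗ[ℂ] Mat d) (lam : ℂ)

/-- The r-matrix applied to the commutator of a point and a covector of the phase space. The
diagonal blocks of this commutator are `v xᵀ - ξ wᵀ` and `-(xᵀ v - wᵀ ξ)`. -/
def blockMoment (m : PhaseSpace n d) (α : Module.Dual ℂ (PhaseSpace n d)) :
    Matrix (Fin n ⊕ Fin d) (Fin n ⊕ Fin d) ℂ :=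
  blockR R ρ (oddBlock m * covBlock α - covBlock α * oddBlock m)

/-- Twice the Hamiltonian vector of the covector `α`, as a block matrix. -/
def blockVector (m : PhaseSpace n d) (α : Module.Dual ℂ (PhaseSpace n d)) :
    Matrix (Fin n ⊕ Fin d) (Fin n ⊕ Fin d) ℂ :=
  (blockMoment R ρ m α * oddBlock m - oddBlock m * blockMoment R ρ m α) -
    grading n d * ((oddBlock m * oddBlock m + lam • 1) * covBlock α +
      covBlock α * (oddBlock m * oddBlock m + lam • 1))

/-- The derivative of `blockVector R ρ lam m α` with respect to `m` in the direction `u`. -/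
def blockVectorDeriv (m u : PhaseSpace n d) (α : Module.Dual ℂ (PhaseSpace n d)) :
    Matrix (Fin n ⊕ Fin d) (Fin n ⊕ Fin d) ℂ :=
  ((blockMoment R ρ u α * oddBlock m + blockMoment R ρ m α * oddBlock u) -
    (oddBlock u * blockMoment R ρ m α + oddBlock m * blockMoment R ρ u α)) -
    grading n d * ((oddBlock u * oddBlock m + oddBlock m * oddBlock u) * covBlock α +
      covBlock α * (oddBlock u * oddBlock m + oddBlock m * oddBlock u))

/-- The Hamiltonian vector `P_m (α, ·)`. The block matrix `blockVector R ρ lam m α` is odd, so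
nothing is lost by taking its odd part. -/
noncomputable def phaseVector (m : PhaseSpace n d) (α : Module.Dual ℂ (PhaseSpace n d)) :
    PhaseSpace n d :=
  oddPart ((1 / 2 : ℂ) • blockVector R ρ lam m α)

/-- The derivative of `phaseVector R ρ lam m α` with respect to `m` in the direction `u`. -/
noncomputable def phaseVectorDeriv (m u : PhaseSpace n d) (α : Module.Dual ℂ (PhaseSpace n d)) :
    PhaseSpace n d :=
  oddPart ((1 / 2 : ℂ) • blockVectorDeriv R ρ m u α)

theorem covBlock_add (α β : Module.Dual ℂ (PhaseSpace n d)) :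
    covBlock (α + β) = covBlock α + covBlock β := by
  rw [covBlock, covBlock, covBlock, ← map_add]
  rfl

theorem covBlock_smul (r : ℂ) (α : Module.Dual ℂ (PhaseSpace n d)) :
    covBlock (r • α) = r • covBlock α := by
  rw [covBlock, covBlock, ← map_smul]
  rfl

theorem blockVector_mul_grading (m : PhaseSpace n d) (α : Module.Dual ℂ (PhaseSpace n d)) :
    blockVector R ρ lam m α * grading n d = -(grading n d * blockVector R ρ lam m α) := by
  have hN := oddBlock_mul_grading m
  have hN2 : ∀ w, oddBlock m * (grading n d * w) = -(grading n d * (oddBlock m * w)) := fun w => by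
    rw [← mul_assoc, hN, neg_mul, mul_assoc]
  have hr : blockMoment R ρ m α * grading n d = grading n d * blockMoment R ρ m α :=
    blockR_mul_grading R ρ _
  have hr2 : ∀ w, blockMoment R ρ m α * (grading n d * w) =
      grading n d * (blockMoment R ρ m α * w) := fun w => by
    rw [← mul_assoc, hr, mul_assoc]
  have ha := covBlock_mul_grading α
  have ha2 : ∀ w, covBlock α * (grading n d * w) = -(grading n d * (covBlock α * w)) := fun w => by
    rw [← mul_assoc, ha, neg_mul, mul_assoc]
  simp only [blockVector, mul_sub, sub_mul, mul_add, add_mul, mul_assoc, smul_mul_assoc,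
    mul_smul_comm, one_mul, mul_one, hN, hN2, hr, hr2, ha, ha2, mul_neg, neg_neg, smul_neg]
  abel

theorem oddBlock_phaseVector (m : PhaseSpace n d) (α : Module.Dual ℂ (PhaseSpace n d)) :
    oddBlock (phaseVector R ρ lam m α) = (1 / 2 : ℂ) • blockVector R ρ lam m α := by
  refine oddBlock_oddPart ?_
  rw [smul_mul_assoc, blockVector_mul_grading, smul_neg, mul_smul_comm]

variable {R ρ}

/-- The Poisson tensor in terms of block matrices `N` for the point and `a`, `b` for the covectors:
`P (α, β) = (-tr ([N, a] R [N, b]) - tr (s (N² + λ) [a, b])) / 2`. -/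
theorem apply_phaseVector (hR : IsRMatrix R) (hρ : IsRMatrix ρ) (m : PhaseSpace n d)
    (α β : Module.Dual ℂ (PhaseSpace n d)) :
    β (phaseVector R ρ lam m α) = (1 / 2 : ℂ) *
      (-((oddBlock m * covBlock α - covBlock α * oddBlock m) * blockMoment R ρ m β).trace -
        (grading n d * (oddBlock m * oddBlock m + lam • 1) *
          (covBlock α * covBlock β - covBlock β * covBlock α)).trace) := by
  have h1 := blockR_skew hR hρ (oddBlock m * covBlock α - covBlock α * oddBlock m)
    (oddBlock m * covBlock β - covBlock β * oddBlock m)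
  have hb := covBlock_mul_grading β
  have hN := oddBlock_mul_grading m
  rw [← blockMoment, ← blockMoment] at h1
  rw [phaseVector, ← trace_covBlock_mul, blockVector, h1]
  set s := grading n d
  set N := oddBlock m
  set a := covBlock α
  set b := covBlock β
  set ra := blockMoment R ρ m α
  have hM : (N * N + lam • 1) * s = s * (N * N + lam • 1) := by
    rw [add_mul, mul_add, mul_assoc, hN, mul_neg, ← mul_assoc, hN, neg_mul, neg_neg, mul_assoc,
      smul_mul_assoc, mul_smul_comm, one_mul, mul_one]
  set M := N * N + lam • 1
  have h2 : (b * (ra * N - N * ra)).trace = (ra * (N * b - b * N)).trace := by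
    rw [mul_sub, mul_sub, trace_sub, trace_sub, trace_mul_comm b, trace_mul_comm b, mul_assoc,
      mul_assoc, trace_mul_comm N, mul_assoc]
  have h3 : (b * (s * (M * a))).trace = (s * M * (a * b)).trace := by
    rw [trace_mul_comm b]
    simp only [mul_assoc]
  have h4 : (b * (s * (a * M))).trace = -(s * M * (b * a)).trace := by
    rw [← mul_assoc, hb, neg_mul, trace_neg, ← mul_assoc, trace_mul_comm _ M, ← hM]
    simp only [mul_assoc]
  rw [mul_smul_comm, trace_smul, smul_eq_mul, mul_sub, trace_sub, h2, mul_add, mul_add, trace_add,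
    h3, h4, mul_sub (s * M), trace_sub]
  ring

theorem poissonTensor_eq (hR : IsRMatrix R) (hρ : IsRMatrix ρ) (m : PhaseSpace n d)
    (α β : Module.Dual ℂ (PhaseSpace n d)) :
    poissonTensor R ρ lam m α β = β (phaseVector R ρ lam m α) := by
  rw [apply_phaseVector lam hR hρ, blockMoment, covBlock, covBlock, oddBlock_commutator,
    oddBlock_commutator, oddBlock_commutator, poissonTensor]
  have h1 : oddBlock m * oddBlock m + lam • (1 : Matrix (Fin n ⊕ Fin d) (Fin n ⊕ Fin d) ℂ) =
      fromBlocks (m.1 * m.2 + lam • 1) 0 0 (m.2 * m.1 + lam • 1) := by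
    rw [← fromBlocks_one, fromBlocks_smul]
    simp [oddBlock_apply, fromBlocks_multiply, fromBlocks_add]
  have h2 : ρ (m.2 * covXi β - covX β * m.1) = -ρ (covX β * m.1 - m.2 * covXi β) := by
    rw [← map_neg, neg_sub]
  have h3 : m.2 * covXi α - covX α * m.1 = -(covX α * m.1 - m.2 * covXi α) := (neg_sub _ _).symm
  have h4 : (covX α * covXi β).trace = (covXi β * covX α).trace := trace_mul_comm _ _
  have h5 : (covX β * covXi α).trace = (covXi α * covX β).trace := trace_mul_comm _ _
  rw [h1, grading]
  simp only [blockR, LinearMap.coe_mk, AddHom.coe_mk, toBlocks_fromBlocks₁₁,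
    toBlocks_fromBlocks₂₂, fromBlocks_multiply, trace_fromBlocks, h2, Matrix.mul_zero,
    Matrix.zero_mul, add_zero, zero_add, Matrix.one_mul, Matrix.neg_mul, Matrix.mul_neg, trace_neg]
  rw [h3]
  simp only [Matrix.neg_mul, trace_neg, Matrix.add_mul, Matrix.sub_mul, trace_add,
    trace_sub, Matrix.smul_mul, trace_smul, Matrix.one_mul, smul_eq_mul, mul_sub,
    neg_neg, h4, h5]
  ring

theorem phaseVector_skew (hR : IsRMatrix R) (hρ : IsRMatrix ρ) (m : PhaseSpace n d)
    (α β : Module.Dual ℂ (PhaseSpace n d)) :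
    β (phaseVector R ρ lam m α) = -α (phaseVector R ρ lam m β) := by
  have h1 := blockR_skew hR hρ (oddBlock m * covBlock α - covBlock α * oddBlock m)
    (oddBlock m * covBlock β - covBlock β * oddBlock m)
  rw [trace_mul_comm (blockR _ _ _)] at h1
  rw [apply_phaseVector lam hR hρ, apply_phaseVector lam hR hρ, blockMoment, blockMoment, h1,
    ← neg_sub (covBlock α * covBlock β), mul_neg, trace_neg]
  ring

/-- The derivative of the Poisson tensor, as the trace of the direction `u` times a block matrix;
this is the form that enters the Jacobi identity. -/
theorem apply_phaseVectorDeriv (hR : IsRMatrix R) (hρ : IsRMatrix ρ) (m u : PhaseSpace n d)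
    (β γ : Module.Dual ℂ (PhaseSpace n d)) :
    γ (phaseVectorDeriv R ρ m u β) = (1 / 2 : ℂ) *
      (oddBlock u * (((covBlock γ * blockMoment R ρ m β - blockMoment R ρ m β * covBlock γ) -
        (covBlock β * blockMoment R ρ m γ - blockMoment R ρ m γ * covBlock β)) -
        grading n d * ((covBlock β * covBlock γ - covBlock γ * covBlock β) * oddBlock m -
          oddBlock m * (covBlock β * covBlock γ - covBlock γ * covBlock β)))).trace := by
  rw [phaseVectorDeriv, ← trace_covBlock_mul, mul_smul_comm, trace_smul, smul_eq_mul,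
    blockVectorDeriv]
  have h1 := blockR_skew hR hρ (oddBlock m * covBlock γ - covBlock γ * oddBlock m)
    (oddBlock u * covBlock β - covBlock β * oddBlock u)
  have hb := covBlock_mul_grading β
  have hc := covBlock_mul_grading γ
  have hN := oddBlock_mul_grading m
  rw [← blockMoment, ← blockMoment] at h1
  set s := grading n d
  set N := oddBlock m
  set U := oddBlock u
  set b := covBlock β
  set c := covBlock γ
  set rb := blockMoment R ρ m β
  set rc := blockMoment R ρ m γ
  set K := blockMoment R ρ u β
  have hN2 : ∀ w, N * (s * w) = -(s * (N * w)) := fun w => by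
    rw [← mul_assoc, hN, neg_mul, mul_assoc]
  have hc2 : ∀ w, c * (s * w) = -(s * (c * w)) := fun w => by
    rw [← mul_assoc, hc, neg_mul, mul_assoc]
  have tN : ∀ w, (N * w).trace = (w * N).trace := fun w => trace_mul_comm _ _
  have tb : ∀ w, (b * w).trace = (w * b).trace := fun w => trace_mul_comm _ _
  have tc : ∀ w, (c * w).trace = (w * c).trace := fun w => trace_mul_comm _ _
  have ts : ∀ w, (s * w).trace = (w * s).trace := fun w => trace_mul_comm _ _
  have trb : ∀ w, (rb * w).trace = (w * rb).trace := fun w => trace_mul_comm _ _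
  have trc : ∀ w, (rc * w).trace = (w * rc).trace := fun w => trace_mul_comm _ _
  congr 1
  -- rotate every word so that it begins with `U` or with `K`
  simp only [mul_sub, sub_mul, mul_add, add_mul, mul_assoc, trace_sub, trace_add, trace_neg,
    mul_neg, neg_neg, hN, hb, hN2, hc2, tN, tb, tc, ts, trb, trc] at h1 ⊢
  linear_combination h1

theorem isPoissonHamiltonian_phaseSpace (hR : IsRMatrix R) (hρ : IsRMatrix ρ) :
    IsPoissonHamiltonian Set.univ (phaseVector R ρ lam) (phaseVectorDeriv R ρ) where
  isOpen := isOpen_univ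
  analytic m _ α := by
    have h0 : AnalyticAt ℂ (fun x : PhaseSpace n d => x) m := analyticAt_id
    have hN := analyticAt_linearMap_comp oddBlock h0
    have ha : AnalyticAt ℂ (fun _ : PhaseSpace n d => covBlock α) m := analyticAt_const
    have hs : AnalyticAt ℂ (fun _ : PhaseSpace n d => grading n d) m := analyticAt_const
    have hr := analyticAt_linearMap_comp (blockR R ρ)
      ((analyticAt_matrix_mul hN ha).sub (analyticAt_matrix_mul ha hN))
    have hM := (analyticAt_matrix_mul hN hN).add (analyticAt_const (v :=
      lam • (1 : Matrix (Fin n ⊕ Fin d) (Fin n ⊕ Fin d) ℂ)))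
    exact analyticAt_linearMap_comp (oddPart ∘ₗ LinearMap.lsmul ℂ _ (1 / 2 : ℂ))
      (((analyticAt_matrix_mul hr hN).sub (analyticAt_matrix_mul hN hr)).sub
      (analyticAt_matrix_mul hs ((analyticAt_matrix_mul hM ha).add (analyticAt_matrix_mul ha hM))))
  map_add m α β := by
    have h := covBlock_add α β
    change phaseVector R ρ lam m (α + β) = phaseVector R ρ lam m α + phaseVector R ρ lam m β
    rw [phaseVector, phaseVector, phaseVector, ← map_add, ← smul_add]
    congr 2
    simp only [blockVector, blockMoment, h, mul_add, add_mul, map_add, map_sub, sub_mul, mul_sub]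
    abel
  map_smul m c α := by
    have h := covBlock_smul c α
    change phaseVector R ρ lam m (c • α) = c • phaseVector R ρ lam m α
    rw [phaseVector, phaseVector, ← map_smul, smul_comm c]
    congr 2
    simp only [blockVector, blockMoment, h, smul_mul_assoc, mul_smul_comm, map_smul, ← smul_sub,
      ← smul_add]
  skew m _ α β := phaseVector_skew lam hR hρ m α β
  hasDerivAt m _ u α := by
    have hN := hasDerivAt_linearMap_comp oddBlock (hasDerivAt_add_smul m u)
    have ha := hasDerivAt_const (0 : ℂ) (covBlock α)
    have hs := hasDerivAt_const (0 : ℂ) (grading n d)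
    have hr := hasDerivAt_linearMap_comp (blockR R ρ)
      ((hasDerivAt_matrix_mul hN ha).sub (hasDerivAt_matrix_mul ha hN))
    have hM := (hasDerivAt_matrix_mul hN hN).add (hasDerivAt_const (0 : ℂ)
      (lam • (1 : Matrix (Fin n ⊕ Fin d) (Fin n ⊕ Fin d) ℂ)))
    have h := hasDerivAt_linearMap_comp (oddPart ∘ₗ LinearMap.lsmul ℂ _ (1 / 2 : ℂ))
      (((hasDerivAt_matrix_mul hr hN).sub (hasDerivAt_matrix_mul hN hr)).sub
      (hasDerivAt_matrix_mul hs ((hasDerivAt_matrix_mul hM ha).add (hasDerivAt_matrix_mul ha hM))))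
    refine h.congr_deriv ?_
    simp [phaseVectorDeriv, blockVectorDeriv, blockMoment]
  jacobi m _ α β γ := by
    rw [apply_phaseVectorDeriv hR hρ, apply_phaseVectorDeriv hR hρ, apply_phaseVectorDeriv hR hρ,
      oddBlock_phaseVector, oddBlock_phaseVector, oddBlock_phaseVector]
    have hcyc := blockR_trace_cyclic hR hρ (m.1 * covX α - covXi α * m.2)
      (m.1 * covX β - covXi β * m.2) (m.1 * covX γ - covXi γ * m.2) (m.2 * covXi α - covX α * m.1)
      (m.2 * covXi β - covX β * m.1) (m.2 * covXi γ - covX γ * m.1)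
    have hcomm : ∀ α : Module.Dual ℂ (PhaseSpace n d),
        fromBlocks (m.1 * covX α - covXi α * m.2) 0 0 (m.2 * covXi α - covX α * m.1) =
          oddBlock m * covBlock α - covBlock α * oddBlock m := fun α =>
      (oddBlock_commutator m (covXi α, covX α)).symm
    rw [hcomm, hcomm, hcomm, ← blockMoment, ← blockMoment, ← blockMoment] at hcyc
    have h1 := phaseSpace_trace_identity (lam := lam) (grading_mul_self (n := n) (d := d))
      (oddBlock_mul_grading m) (covBlock_mul_grading α) (covBlock_mul_grading β)
      (covBlock_mul_grading γ) (blockR_mul_grading R ρ _) (blockR_mul_grading R ρ _)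
      (blockR_mul_grading R ρ _) hcyc
    simp only [smul_mul_assoc, trace_smul, smul_eq_mul, blockVector, blockMoment] at h1 ⊢
    linear_combination (1 / 4 : ℂ) * h1

/-- The bracket on the phase space is a Poisson bracket. -/
theorem isPoissonBracket_phaseSpace (hR : IsRMatrix R) (hρ : IsRMatrix ρ) :
    IsPoissonBracket Set.univ (bracketOf (poissonTensor R ρ lam)) :=
  (isPoissonHamiltonian_phaseSpace lam hR hρ).isPoissonBracket fun _ _ m _ =>
    poissonTensor_eq lam hR hρ m _ _

end PhaseSpacePoisson

/-! ### The dual Lie algebra and the dual group -/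

section DualGroup

variable {k : ℕ} {R : Mat k →ₗ[ℂ] Mat k}

theorem rPlus_apply (X : Mat k) : rPlus R X = (1 / 2 : ℂ) • (R X + X) := rfl

theorem rMinus_apply (X : Mat k) : rMinus R X = (1 / 2 : ℂ) • (R X - X) := rfl

theorem rPlus_sub_rMinus (X : Mat k) : rPlus R X - rMinus R X = X := by
  rw [rPlus_apply, rMinus_apply]
  module

theorem mk_mem_dualAlgebra (X : Mat k) : (rPlus R X, rMinus R X) ∈ dualAlgebra R := ⟨X, rfl⟩

/-- The dual algebra meets the diagonal of the double only in zero. -/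
theorem eq_zero_of_rPlus_eq_rMinus {X : Mat k} (h : rPlus R X = rMinus R X) : X = 0 := by
  rw [← rPlus_sub_rMinus (R := R) X, h, sub_self]

/-- By the modified Yang-Baxter equation, the dual algebra is a Lie subalgebra of the double. -/
theorem commutator_mem_dualAlgebra (hR : IsRMatrix R) {a b : Mat k × Mat k}
    (ha : a ∈ dualAlgebra R) (hb : b ∈ dualAlgebra R) : a * b - b * a ∈ dualAlgebra R := by
  obtain ⟨X, rfl⟩ := ha
  obtain ⟨Y, rfl⟩ := hb
  refine ⟨(1 / 2 : ℂ) • (⁅R X, Y⁆ + ⁅X, R Y⁆), ?_⟩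
  have h : R (⁅R X, Y⁆ + ⁅X, R Y⁆) = ⁅R X, R Y⁆ + ⁅X, Y⁆ := by
    have h := hR.yangBaxter X Y
    rw [sub_add_eq_add_sub, sub_eq_zero] at h
    exact h.symm
  have h' : R ((1 / 2 : ℂ) • (⁅R X, Y⁆ + ⁅X, R Y⁆)) = (1 / 2 : ℂ) • (⁅R X, R Y⁆ + ⁅X, Y⁆) := by
    rw [map_smul, h]
  refine Prod.ext ?_ ?_
  · change rPlus R _ = rPlus R X * rPlus R Y - rPlus R Y * rPlus R X
    rw [rPlus_apply, h']
    simp only [rPlus_apply, Ring.lie_def, smul_mul_assoc, mul_smul_comm, add_mul,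
      mul_add, smul_add, smul_sub]
    module
  · change rMinus R _ = rMinus R X * rMinus R Y - rMinus R Y * rMinus R X
    rw [rMinus_apply, h']
    simp only [rMinus_apply, Ring.lie_def, smul_mul_assoc, mul_smul_comm, sub_mul,
      mul_sub, smul_add, smul_sub]
    module

-- The maximum row sum norm makes the matrices a Banach algebra, but only its normed space
-- structure is an instance here. The lemmas on Banach algebras are therefore restated for pairs of
-- matrices.
theorem fst_exp (a : Mat k × Mat k) : (NormedSpace.exp a).1 = NormedSpace.exp a.1 :=
  letI := Matrix.linftyOpNormedRing (n := Fin k) (α := ℂ)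
  letI := Matrix.linftyOpNormedAlgebra (R := ℂ) (n := Fin k) (α := ℂ)
  letI := NormedAlgebra.restrictScalars ℚ ℂ (Mat k)
  Prod.fst_exp a

theorem snd_exp (a : Mat k × Mat k) : (NormedSpace.exp a).2 = NormedSpace.exp a.2 :=
  letI := Matrix.linftyOpNormedRing (n := Fin k) (α := ℂ)
  letI := Matrix.linftyOpNormedAlgebra (R := ℂ) (n := Fin k) (α := ℂ)
  letI := NormedAlgebra.restrictScalars ℚ ℂ (Mat k)
  Prod.snd_exp a

theorem analyticAt_exp_prod (a : Mat k × Mat k) :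
    AnalyticAt ℂ (NormedSpace.exp : Mat k × Mat k → Mat k × Mat k) a :=
  letI := Matrix.linftyOpNormedRing (n := Fin k) (α := ℂ)
  letI := Matrix.linftyOpNormedAlgebra (R := ℂ) (n := Fin k) (α := ℂ)
  NormedSpace.exp_analytic a

theorem hasStrictFDerivAt_exp_mat_zero :
    HasStrictFDerivAt (NormedSpace.exp : Mat k → Mat k) (ContinuousLinearMap.id ℂ (Mat k)) 0 :=
  letI := Matrix.linftyOpNormedRing (n := Fin k) (α := ℂ)
  letI := Matrix.linftyOpNormedAlgebra (R := ℂ) (n := Fin k) (α := ℂ)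
  hasStrictFDerivAt_exp_zero

theorem analyticAt_exp_mat (a : Mat k) :
    AnalyticAt ℂ (NormedSpace.exp : Mat k → Mat k) a :=
  letI := Matrix.linftyOpNormedRing (n := Fin k) (α := ℂ)
  letI := Matrix.linftyOpNormedAlgebra (R := ℂ) (n := Fin k) (α := ℂ)
  NormedSpace.exp_analytic a

theorem exp_conj_mem_dualAlgebra (hR : IsRMatrix R) {a b : Mat k × Mat k}
    (hb : b ∈ dualAlgebra R) (ha : a ∈ dualAlgebra R) :
    NormedSpace.exp b * a * NormedSpace.exp (-b) ∈ dualAlgebra R :=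
  letI := Matrix.linftyOpNormedRing (n := Fin k) (α := ℂ)
  letI := Matrix.linftyOpNormedAlgebra (R := ℂ) (n := Fin k) (α := ℂ)
  exp_conj_mem (fun _ hx => commutator_mem_dualAlgebra hR hb hx) ha

theorem fderiv_exp_mem_dualAlgebra (hR : IsRMatrix R) {a b : Mat k × Mat k}
    (ha : a ∈ dualAlgebra R) (hb : b ∈ dualAlgebra R) :
    fderiv ℂ (NormedSpace.exp : Mat k × Mat k → Mat k × Mat k) a b * NormedSpace.exp (-a) ∈
      dualAlgebra R :=
  letI := Matrix.linftyOpNormedRing (n := Fin k) (α := ℂ)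
  letI := Matrix.linftyOpNormedAlgebra (R := ℂ) (n := Fin k) (α := ℂ)
  fderiv_exp_mul_exp_neg_mem (fun _ hx => commutator_mem_dualAlgebra hR ha hx) hb

theorem exp_prod_mul_exp_neg (a : Mat k × Mat k) :
    NormedSpace.exp a * NormedSpace.exp (-a) = 1 :=
  letI := Matrix.linftyOpNormedRing (n := Fin k) (α := ℂ)
  letI := Matrix.linftyOpNormedAlgebra (R := ℂ) (n := Fin k) (α := ℂ)
  exp_mul_exp_neg_self a

/-- The dual algebra is stable under conjugation by the dual group. -/
theorem conj_mem_dualAlgebra_iff (hR : IsRMatrix R) {g : GL (Fin k) ℂ × GL (Fin k) ℂ}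
    (hg : g ∈ dualGroup R) (a : Mat k × Mat k) :
    ((g.1 : Mat k) * a.1 * ((g.1⁻¹ : GL (Fin k) ℂ) : Mat k),
      (g.2 : Mat k) * a.2 * ((g.2⁻¹ : GL (Fin k) ℂ) : Mat k)) ∈ dualAlgebra R ↔
      a ∈ dualAlgebra R := by
  induction hg using Subgroup.closure_induction generalizing a with
  | mem g hg =>
    obtain ⟨b, hb, h1, h2⟩ := hg
    have h1' : ((g.1⁻¹ : GL (Fin k) ℂ) : Mat k) = NormedSpace.exp (-b.1) := by
      rw [Matrix.coe_units_inv, h1, Matrix.exp_neg]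
    have h2' : ((g.2⁻¹ : GL (Fin k) ℂ) : Mat k) = NormedSpace.exp (-b.2) := by
      rw [Matrix.coe_units_inv, h2, Matrix.exp_neg]
    have h3 : ∀ a : Mat k × Mat k, ((g.1 : Mat k) * a.1 * ((g.1⁻¹ : GL (Fin k) ℂ) : Mat k),
        (g.2 : Mat k) * a.2 * ((g.2⁻¹ : GL (Fin k) ℂ) : Mat k)) =
          NormedSpace.exp b * a * NormedSpace.exp (-b) := fun a => by
      refine Prod.ext ?_ ?_
      · rw [Prod.fst_mul, Prod.fst_mul, fst_exp, fst_exp, h1', h1]; rfl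
      · rw [Prod.snd_mul, Prod.snd_mul, snd_exp, snd_exp, h2', h2]; rfl
    rw [h3]
    refine ⟨fun h => ?_, exp_conj_mem_dualAlgebra hR hb⟩
    have h4 := exp_conj_mem_dualAlgebra hR (neg_mem hb) h
    have h5 := exp_prod_mul_exp_neg (-b)
    rw [neg_neg] at h4 h5
    rwa [mul_assoc (NormedSpace.exp b), ← mul_assoc _ (NormedSpace.exp b), h5, one_mul, mul_assoc,
      h5, mul_one] at h4
  | one => simp
  | mul g h _ _ ihg ihh =>
    rw [← ihh a, ← ihg ((h.1 : Mat k) * a.1 * ((h.1⁻¹ : GL (Fin k) ℂ) : Mat k), _)]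
    simp only [Prod.fst_mul, Prod.snd_mul, _root_.mul_inv_rev, Units.val_mul, mul_assoc]
  | inv g _ ih =>
    rw [← ih]
    simp only [Prod.fst_inv, Prod.snd_inv, inv_inv, mul_assoc, Units.mul_inv, mul_one,
      Units.mul_inv_cancel_left]

/-- The differential of `(g₊, g₋) ↦ g₊ g₋⁻¹` on the dual group is injective. -/
theorem eq_zero_of_rPlus_mul_eq (hR : IsRMatrix R) {g : GL (Fin k) ℂ × GL (Fin k) ℂ}
    (hg : g ∈ dualGroup R) {X : Mat k}
    (h : rPlus R X * ((g.1 : Mat k) * (g.2 : Mat k)⁻¹) =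
      (g.1 : Mat k) * (g.2 : Mat k)⁻¹ * rMinus R X) : X = 0 := by
  have h1 := (conj_mem_dualAlgebra_iff hR (inv_mem hg) _).mpr (mk_mem_dualAlgebra (R := R) X)
  obtain ⟨Y, hY⟩ := h1
  have hYp : rPlus R Y = ((g.1⁻¹ : GL (Fin k) ℂ) : Mat k) * rPlus R X * (g.1 : Mat k) := by
    simpa using congrArg Prod.fst hY
  have hYm : rMinus R Y = ((g.2⁻¹ : GL (Fin k) ℂ) : Mat k) * rMinus R X * (g.2 : Mat k) := by
    simpa using congrArg Prod.snd hY
  rw [← Matrix.coe_units_inv] at h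
  have h2 : rPlus R Y = rMinus R Y := by
    have h3 := congrArg (fun A => ((g.1⁻¹ : GL (Fin k) ℂ) : Mat k) * A * (g.2 : Mat k)) h
    simp only [mul_assoc, Units.inv_mul, mul_one, Units.inv_mul_cancel_left] at h3
    rw [hYp, hYm, mul_assoc, h3, mul_assoc]
  have h4 := eq_zero_of_rPlus_eq_rMinus h2
  rw [h4, map_zero] at hYp hYm
  have h5 : rPlus R X = 0 := by
    have h6 := congrArg (fun A => (g.1 : Mat k) * A * ((g.1⁻¹ : GL (Fin k) ℂ) : Mat k)) hYp
    simpa [mul_assoc] using h6.symm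
  have h5' : rMinus R X = 0 := by
    have h6 := congrArg (fun A => (g.2 : Mat k) * A * ((g.2⁻¹ : GL (Fin k) ℂ) : Mat k)) hYm
    simpa [mul_assoc] using h6.symm
  exact eq_zero_of_rPlus_eq_rMinus (h5.trans h5'.symm)

end DualGroup

/-! ### Local factorizations -/

section Factorization

variable {k : ℕ} {R : Mat k →ₗ[ℂ] Mat k}

/-- `X ↦ exp (X₊) A exp (-X₋)`, the map `(g₊, g₋) ↦ g₊ g₋⁻¹` near a point of the dual group over
`A`, in an exponential chart. -/
noncomputable def twistedExp (R : Mat k →ₗ[ℂ] Mat k) (A X : Mat k) : Mat k :=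
  NormedSpace.exp (rPlus R X) * A * NormedSpace.exp (-rMinus R X)

theorem analyticAt_twistedExp (A X : Mat k) : AnalyticAt ℂ (twistedExp R A) X := by
  have h0 : AnalyticAt ℂ (fun X : Mat k => X) X := analyticAt_id
  have h1 : AnalyticAt ℂ (fun X => NormedSpace.exp (rPlus R X)) X :=
    AnalyticAt.fun_comp_of_eq (analyticAt_exp_mat _) (analyticAt_linearMap_comp (rPlus R) h0) rfl
  have h2 : AnalyticAt ℂ (fun X => NormedSpace.exp (-rMinus R X)) X :=
    AnalyticAt.fun_comp_of_eq (analyticAt_exp_mat _)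
      (analyticAt_linearMap_comp (-rMinus R) h0) rfl
  exact analyticAt_matrix_mul (analyticAt_matrix_mul h1 analyticAt_const) h2

/-- The differential of `X ↦ exp (X₊) A exp (-X₋)` at zero is `X ↦ X₊ A - A X₋`. -/
theorem hasFDerivAt_twistedExp_zero (A : Mat k) :
    HasFDerivAt (twistedExp R A)
      (LinearMap.toContinuousLinearMap (LinearMap.mulRight ℂ A ∘ₗ rPlus R -
        LinearMap.mulLeft ℂ A ∘ₗ rMinus R)) 0 := by
  have he : ∀ L : Mat k →ₗ[ℂ] Mat k, HasFDerivAt (fun X => NormedSpace.exp (L X))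
      L.toContinuousLinearMap 0 := fun L => by
    have h := hasStrictFDerivAt_exp_mat_zero (k := k).hasFDerivAt
    rw [← map_zero L.toContinuousLinearMap] at h
    exact HasFDerivAt.comp (0 : Mat k) h L.toContinuousLinearMap.hasFDerivAt
  obtain ⟨L₁, h₁, e₁⟩ := hasFDerivAt_matrix_mul (he (rPlus R)) (hasFDerivAt_const A (0 : Mat k))
  obtain ⟨L₂, h₂, e₂⟩ := hasFDerivAt_matrix_mul h₁ (he (-rMinus R))
  refine h₂.congr_fderiv ?_
  ext1 u
  rw [e₂, e₁]
  change (rPlus R u * A + NormedSpace.exp (rPlus R 0) * 0) * NormedSpace.exp (-rMinus R 0) +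
    NormedSpace.exp (rPlus R 0) * A * -rMinus R u = rPlus R u * A - A * rMinus R u
  simp [sub_eq_add_neg]

/-- By the inverse function theorem, `X ↦ exp (X₊) A exp (-X₋)` has a local holomorphic inverse
`σ` at a point `A` that factorizes through the dual group. -/
theorem exists_analyticAt_twistedExp_eq (hR : IsRMatrix R) {g : GL (Fin k) ℂ × GL (Fin k) ℂ}
    (hg : g ∈ dualGroup R) {A : Mat k} (hA : (g.1 : Mat k) * (g.2 : Mat k)⁻¹ = A) :
    ∃ σ : Mat k → Mat k, AnalyticAt ℂ σ A ∧ σ A = 0 ∧ ∀ᶠ B in nhds A, twistedExp R A (σ B) = B := by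
  have h0 : twistedExp R A 0 = A := by simp [twistedExp]
  let D : Mat k →ₗ[ℂ] Mat k := LinearMap.mulRight ℂ A ∘ₗ rPlus R - LinearMap.mulLeft ℂ A ∘ₗ rMinus R
  have hD : Function.Injective D := by
    rw [← LinearMap.ker_eq_bot, LinearMap.ker_eq_bot']
    intro X hX
    have h : rPlus R X * A - A * rMinus R X = 0 := hX
    refine eq_zero_of_rPlus_mul_eq hR hg ?_
    rw [hA]
    exact sub_eq_zero.mp h
  let e : Mat k ≃L[ℂ] Mat k := (LinearEquiv.ofInjectiveEndo D hD).toContinuousLinearEquiv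
  have hd : HasFDerivAt (twistedExp R A) (e : Mat k →L[ℂ] Mat k) 0 :=
    (hasFDerivAt_twistedExp_zero A).congr_fderiv (by ext1 u; rfl)
  have hs : HasStrictFDerivAt (twistedExp R A) (e : Mat k →L[ℂ] Mat k) 0 :=
    (analyticAt_twistedExp (R := R) A 0).hasStrictFDerivAt.congr_fderiv hd.fderiv
  let f := hs.toOpenPartialHomeomorph
  have hf : (f : Mat k → Mat k) = twistedExp R A := hs.toOpenPartialHomeomorph_coe
  have hmem : (0 : Mat k) ∈ f.source := hs.mem_toOpenPartialHomeomorph_source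
  have hf0 : f 0 = A := by rw [hf, h0]
  refine ⟨f.symm, ?_, ?_, ?_⟩
  · have h := f.analyticAt_symm' (i := e) hmem (by rw [hf]; exact analyticAt_twistedExp A 0)
      (by rw [hf]; exact hd.fderiv)
    rwa [hf0] at h
  · rw [← hf0, f.left_inv hmem]
  · have ht : f.target ∈ nhds A := f.open_target.mem_nhds (hf0 ▸ f.map_source hmem)
    filter_upwards [ht] with B hB
    rw [← hf, f.right_inv hB]

variable {E : Type*} [NormedAddCommGroup E] [NormedSpace ℂ E]

theorem isUnit_coe_prod (g : GL (Fin k) ℂ × GL (Fin k) ℂ) :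
    IsUnit ((g.1 : Mat k) * (g.2 : Mat k)⁻¹) := by
  rw [← Matrix.coe_units_inv]
  exact g.1.isUnit.mul (g.2⁻¹).isUnit

/-- Through every factorization of a value of `Φ` there passes a local holomorphic factorization,
namely `J = (exp (σ(Φ)₊) g₊, exp (σ(Φ)₋) g₋)` in an exponential chart around `(g₊, g₋)`. -/
theorem exists_isFactorization (hR : IsRMatrix R) {Φ : E → Mat k} {m : E}
    (hΦ : AnalyticAt ℂ Φ m) {g : GL (Fin k) ℂ × GL (Fin k) ℂ} (hg : g ∈ dualGroup R)
    (hm : (g.1 : Mat k) * (g.2 : Mat k)⁻¹ = Φ m) :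
    ∃ U J, m ∈ U ∧ IsFactorization R Φ U J ∧ J m = ((g.1 : Mat k), (g.2 : Mat k)) := by
  obtain ⟨σ, hσ, hσ0, hσe⟩ := exists_analyticAt_twistedExp_eq hR hg hm
  have hτ : AnalyticAt ℂ (fun x => σ (Φ x)) m := AnalyticAt.fun_comp_of_eq hσ hΦ rfl
  obtain ⟨U, hU, hUo, hmU⟩ := eventually_nhds_iff.mp
    (hτ.eventually_analyticAt.and (hΦ.continuousAt.eventually hσe))
  let ι : Mat k →ₗ[ℂ] Mat k × Mat k := (rPlus R).prod (rMinus R)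
  let p : Mat k × Mat k := ((g.1 : Mat k), (g.2 : Mat k))
  let J : E → Mat k × Mat k := fun x => NormedSpace.exp (ι (σ (Φ x))) * p
  have hJ1 : ∀ x, (J x).1 = NormedSpace.exp (rPlus R (σ (Φ x))) * (g.1 : Mat k) := fun x =>
    congrArg (· * (g.1 : Mat k)) (fst_exp (ι (σ (Φ x))))
  have hJ2 : ∀ x, (J x).2 = NormedSpace.exp (rMinus R (σ (Φ x))) * (g.2 : Mat k) := fun x =>
    congrArg (· * (g.2 : Mat k)) (snd_exp (ι (σ (Φ x))))
  have hfac : ∀ x ∈ U, (J x).1 * (J x).2⁻¹ = Φ x := fun x hx => by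
    rw [hJ1, hJ2, Matrix.mul_inv_rev, ← Matrix.exp_neg, mul_assoc, ← mul_assoc (g.1 : Mat k), hm,
      ← mul_assoc]
    exact (hU x hx).2
  have hmem : ∀ x, ∃ h ∈ dualGroup R, J x = ((h.1 : Mat k), (h.2 : Mat k)) := fun x => by
    let h : GL (Fin k) ℂ × GL (Fin k) ℂ :=
      ((Matrix.isUnit_exp (rPlus R (σ (Φ x)))).unit, (Matrix.isUnit_exp (rMinus R (σ (Φ x)))).unit)
    have hh : h ∈ dualGroup R :=
      Subgroup.subset_closure ⟨_, mk_mem_dualAlgebra (σ (Φ x)), rfl, rfl⟩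
    exact ⟨h * g, mul_mem hh hg, Prod.ext (hJ1 x) (hJ2 x)⟩
  have hιan : ∀ x ∈ U, AnalyticAt ℂ (fun x => ι (σ (Φ x))) x := fun x hx =>
    analyticAt_linearMap_comp ι (hU x hx).1
  have hean : ∀ x ∈ U, AnalyticAt ℂ (fun x => NormedSpace.exp (ι (σ (Φ x)))) x := fun x hx =>
    AnalyticAt.fun_comp_of_eq (analyticAt_exp_prod _) (hιan x hx) rfl
  have hJd : ∀ x ∈ U, ∀ u, ∃ Y, fderiv ℂ J x u =
      fderiv ℂ (NormedSpace.exp : Mat k × Mat k → Mat k × Mat k) (ι (σ (Φ x))) (ι Y) * p := by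
    intro x hx u
    have h1 := (analyticAt_exp_prod (ι (σ (Φ x)))).differentiableAt.hasFDerivAt
    have h2 := ι.toContinuousLinearMap.hasFDerivAt.comp x (hU x hx).1.differentiableAt.hasFDerivAt
    have h3 := (LinearMap.mulRight ℂ p).toContinuousLinearMap.hasFDerivAt.comp x
      (HasFDerivAt.comp (f := fun x => ι (σ (Φ x))) x h1 h2)
    have h4 : HasFDerivAt J _ x := h3
    exact ⟨fderiv ℂ (fun x => σ (Φ x)) x u,
      congrArg (fun T : E →L[ℂ] Mat k × Mat k => T u) h4.fderiv⟩
  refine ⟨U, J, hmU, ⟨hUo, fun x hx => ?_, ⟨fun x hx => ?_, fun x _ => hmem x, fun x hx u => ?_⟩,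
    hfac⟩, ?_⟩
  · obtain ⟨h, hh, hJx⟩ := hmem x
    have hx' := hfac x hx
    rw [hJx] at hx'
    exact ⟨hx' ▸ isUnit_coe_prod h, h, hh, hx'⟩
  · exact analyticAt_linearMap_comp (LinearMap.mulRight ℂ p) (hean x hx)
  · obtain ⟨Y, hY⟩ := hJd x hx u
    have h1 := fderiv_exp_mem_dualAlgebra hR (mk_mem_dualAlgebra (R := R) (σ (Φ x)))
      (mk_mem_dualAlgebra (R := R) Y)
    have h2 : rightTriv (J x) (fderiv ℂ J x u) =
        fderiv ℂ (NormedSpace.exp : Mat k × Mat k → Mat k × Mat k) (ι (σ (Φ x))) (ι Y) *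
          NormedSpace.exp (-ι (σ (Φ x))) := by
      rw [hY]
      refine Prod.ext ?_ ?_
      · change _ * (g.1 : Mat k) * (J x).1⁻¹ = _ * (NormedSpace.exp (-ι (σ (Φ x)))).1
        rw [hJ1, fst_exp, Prod.fst_neg, Matrix.exp_neg, Matrix.mul_inv_rev, mul_assoc,
          ← mul_assoc (g.1 : Mat k), ← Matrix.coe_units_inv, Units.mul_inv, one_mul]
        rfl
      · change _ * (g.2 : Mat k) * (J x).2⁻¹ = _ * (NormedSpace.exp (-ι (σ (Φ x)))).2
        rw [hJ2, snd_exp, Prod.snd_neg, Matrix.exp_neg, Matrix.mul_inv_rev, mul_assoc,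
          ← mul_assoc (g.2 : Mat k), ← Matrix.coe_units_inv, Units.mul_inv, one_mul]
        rfl
    rw [h2]
    exact h1
  · refine Prod.ext ?_ ?_
    · rw [hJ1, hσ0, map_zero, NormedSpace.exp_zero, one_mul]
    · rw [hJ2, hσ0, map_zero, NormedSpace.exp_zero, one_mul]

end Factorization

/-! ### A criterion for momentum maps -/

section Momentum

variable {k : ℕ} {R : Mat k →ₗ[ℂ] Mat k} {E : Type*}

/-- The scalar matrix `exp z` factorizes as `exp (X₊) exp (-X₋)` with `X = z`, because
`X₊ - X₋ = X` is central. -/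
theorem exp_smul_one_mem_factorDomain {Φ : E → Mat k} {m : E} {z : ℂ}
    (hm : Φ m = Complex.exp z • 1) : m ∈ factorDomain R Φ := by
  have hunit : IsUnit (Φ m) := by
    rw [hm, isUnit_iff_isUnit_det, det_smul, det_one, mul_one]
    exact (IsUnit.mk0 _ (Complex.exp_ne_zero z)).pow _
  let X : Mat k := z • 1
  let g : GL (Fin k) ℂ × GL (Fin k) ℂ :=
    ((Matrix.isUnit_exp (rPlus R X)).unit, (Matrix.isUnit_exp (rMinus R X)).unit)
  refine ⟨hunit, g, Subgroup.subset_closure ⟨_, mk_mem_dualAlgebra X, rfl, rfl⟩, ?_⟩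
  change NormedSpace.exp (rPlus R X) * (NormedSpace.exp (rMinus R X))⁻¹ = Φ m
  have hX : rPlus R X = rMinus R X + X := by
    rw [← sub_eq_iff_eq_add', rPlus_sub_rMinus]
  have hc : Commute (rPlus R X) (-rMinus R X) := by
    rw [hX]
    exact ((Commute.refl _).add_left ((Commute.one_left _).smul_left z)).neg_right
  rw [← Matrix.exp_neg, ← Matrix.exp_add_of_commute _ _ hc, ← sub_eq_add_neg, rPlus_sub_rMinus, hm]
  have h1 : X = diagonal fun _ => z := by simp [X, smul_one_eq_diagonal]
  rw [h1, Matrix.exp_diagonal, smul_one_eq_diagonal, Complex.exp_eq_exp_ℂ]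
  congr 1
  exact Pi.exp_def _

variable [NormedAddCommGroup E] [NormedSpace ℂ E]

/-- The differential of a local factorization `J` of `Φ`: if `dJ (u) J⁻¹ = (Y₊, Y₋)` then
`dΦ (u) = Y₊ Φ - Φ Y₋`. -/
theorem IsFactorization.exists_rightTriv_eq {Φ : E → Mat k} {U : Set E} {J : E → Mat k × Mat k}
    (hJ : IsFactorization R Φ U J) {m : E} (hm : m ∈ U) (hΦ : DifferentiableAt ℂ Φ m) (u : E) :
    ∃ Y, rightTriv (J m) (fderiv ℂ J m u) = (rPlus R Y, rMinus R Y) ∧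
      fderiv ℂ Φ m u = rPlus R Y * Φ m - Φ m * rMinus R Y := by
  obtain ⟨Y, hY⟩ := hJ.holomorphic.tangent m hm u
  refine ⟨Y, hY.symm, ?_⟩
  obtain ⟨g, -, hg⟩ := hJ.holomorphic.mem m hm
  have hY1 : rPlus R Y = (fderiv ℂ J m u).1 * (J m).1⁻¹ := congrArg Prod.fst hY
  have hY2 : rMinus R Y = (fderiv ℂ J m u).2 * (J m).2⁻¹ := congrArg Prod.snd hY
  have hJd := (hJ.holomorphic.analytic m hm).differentiableAt.hasFDerivAt
  have h1 : HasFDerivAt (fun x => (J x).1) _ m := hJd.fst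
  have h2 : HasFDerivAt (fun x => (J x).2) _ m := hJd.snd
  obtain ⟨L, hL, hLu⟩ := hasFDerivAt_matrix_mul hΦ.hasFDerivAt h2
  have hmul : ∀ x ∈ U, Φ x * (J x).2 = (J x).1 := fun x hx => by
    obtain ⟨g, -, hg⟩ := hJ.holomorphic.mem x hx
    rw [← hJ.factor x hx, hg, mul_assoc, ← Matrix.coe_units_inv, Units.inv_mul, mul_one]
  have h3 : HasFDerivAt (fun x => Φ x * (J x).2) _ m :=
    h1.congr_of_eventuallyEq (by filter_upwards [hJ.isOpen.mem_nhds hm] with x hx using hmul x hx)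
  have h4 : L u = (fderiv ℂ J m u).1 := congrArg (fun T : E →L[ℂ] Mat k => T u) (hL.unique h3)
  rw [hLu] at h4
  change fderiv ℂ Φ m u * (J m).2 + Φ m * (fderiv ℂ J m u).2 = (fderiv ℂ J m u).1 at h4
  rw [hY1, hY2, ← h4, ← hJ.factor m hm, hg]
  simp only [← Matrix.coe_units_inv, add_mul, mul_assoc, Units.inv_mul_cancel_left, Units.mul_inv,
    mul_one]
  simp

/-- A sufficient condition for the local factorizations of `Φ` to be momentum maps: the
Hamiltonian vector of a covector `α` moves `Φ` by `Y₊ Φ - Φ Y₋`, where `Y` is the infinitesimal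
action paired with `α`. Since `Y` is determined by this infinitesimal motion, `J^* X̃` sends the
Hamiltonian vector of `α` to `tr (X Y)`. -/
theorem representsMomentumMap_of_hamiltonian (hR : IsRMatrix R)
    {P : E → Module.Dual ℂ E → Module.Dual ℂ E → ℂ} {V : E → Module.Dual ℂ E → E}
    {act : Mat k → E → E} {Φ : E → Mat k} {Y : E → Module.Dual ℂ E → Mat k}
    (hact : IsPoissonAction (sklyanin ((-1 / 2 : ℂ) • R)) (bracketOf P) act)
    (hΦ : ∀ m, IsUnit (Φ m) → AnalyticAt ℂ Φ m) (h0 : (factorDomain R Φ).Nonempty)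
    (hP : ∀ m α β, P m α β = β (V m α))
    (hV : ∀ m, IsUnit (Φ m) → ∀ α,
      fderiv ℂ Φ m (V m α) = rPlus R (Y m α) * Φ m - Φ m * rMinus R (Y m α))
    (hY : ∀ m α X, α (infAction act X m) = (X * Y m α).trace) :
    RepresentsMomentumMap R P act Φ where
  isOpen := isOpen_iff_forall_mem_open.mpr fun m hm => by
    obtain ⟨hu, g, hg, hgm⟩ := hm
    obtain ⟨U, J, hmU, hJ, -⟩ := exists_isFactorization hR (hΦ m hu) hg hgm
    exact ⟨U, hJ.subset, hJ.isOpen, hmU⟩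
  nonempty := h0
  exists_factorization m hm g hg hgm := exists_isFactorization hR (hΦ m hm.1) hg hgm
  isMomentumMap U J hJ :=
    { poissonAction := hact
      isOpen := hJ.isOpen
      holomorphic := hJ.holomorphic
      momentum := fun X m hm α => by
        have hu : IsUnit (Φ m) := (hJ.subset hm).1
        obtain ⟨g, hg, hgm⟩ := (hJ.subset hm).2
        obtain ⟨Z, hZ, hZΦ⟩ := hJ.exists_rightTriv_eq hm (hΦ m hu).differentiableAt (V m α)
        have hZY : Z = Y m α := by
          rw [← sub_eq_zero]
          refine eq_zero_of_rPlus_mul_eq hR hg ?_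
          rw [hgm, map_sub, map_sub, sub_mul, mul_sub, sub_eq_sub_iff_sub_eq_sub, ← hZΦ, hV m hu]
        rw [hP, hY]
        change doublePairing (X, X) (rightTriv (J m) (fderiv ℂ J m (V m α))) = _
        rw [hZ, hZY]
        change (X * rPlus R (Y m α)).trace - (X * rMinus R (Y m α)).trace = _
        rw [← trace_sub, ← mul_sub, rPlus_sub_rMinus] }

end Momentum

/-! ### Matrix inverses and covectors -/

section MatrixInverse

variable {k : ℕ}

theorem analyticAt_matrix_inv {g : Mat k} (hg : IsUnit g) :
    AnalyticAt ℂ (fun a : Mat k => a⁻¹) g := by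
  let := Matrix.linftyOpNormedRing (n := Fin k) (α := ℂ)
  let := Matrix.linftyOpNormedAlgebra (R := ℂ) (n := Fin k) (α := ℂ)
  obtain ⟨u, rfl⟩ := hg
  rw [funext fun a : Mat k => Matrix.nonsing_inv_eq_ringInverse a]
  exact analyticAt_inverse u

/-- The differential of matrix inversion, described by its values, so that the statement does not
involve the Banach algebra structure of the matrices. -/
theorem exists_hasFDerivAt_matrix_inv {g : Mat k} (hg : IsUnit g) :
    ∃ L : Mat k →L[ℂ] Mat k, HasFDerivAt (fun a : Mat k => a⁻¹) L g ∧
      ∀ u, L u = -(g⁻¹ * u * g⁻¹) := by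
  let := Matrix.linftyOpNormedRing (n := Fin k) (α := ℂ)
  let := Matrix.linftyOpNormedAlgebra (R := ℂ) (n := Fin k) (α := ℂ)
  obtain ⟨u, rfl⟩ := hg
  rw [funext fun a : Mat k => Matrix.nonsing_inv_eq_ringInverse a]
  refine ⟨_, hasFDerivAt_ringInverse u, fun v => ?_⟩
  change -((↑u⁻¹ : Mat k) * v * (↑u⁻¹ : Mat k)) = -(Ring.inverse ↑u * v * Ring.inverse ↑u)
  rw [Ring.inverse_unit]

theorem hasDerivAt_exp_smul_mat (X : Mat k) :
    HasDerivAt (fun t : ℂ => NormedSpace.exp (t • X)) X 0 := by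
  let := Matrix.linftyOpNormedRing (n := Fin k) (α := ℂ)
  let := Matrix.linftyOpNormedAlgebra (R := ℂ) (n := Fin k) (α := ℂ)
  have h := hasDerivAt_exp_smul_const X (0 : ℂ)
  rw [zero_smul, NormedSpace.exp_zero, one_mul] at h
  exact h

theorem hasDerivAt_exp_smul_mat_inv (X : Mat k) :
    HasDerivAt (fun t : ℂ => (NormedSpace.exp (t • X))⁻¹) (-X) 0 := by
  have h := hasDerivAt_exp_smul_mat (-X)
  refine h.congr_of_eventuallyEq (Filter.Eventually.of_forall fun t => ?_)
  change (NormedSpace.exp (t • X))⁻¹ = NormedSpace.exp (t • -X)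
  rw [smul_neg, Matrix.exp_neg]

end MatrixInverse

theorem fderiv_comp_toLinearMap {E E' : Type*} [NormedAddCommGroup E] [NormedSpace ℂ E]
    [NormedAddCommGroup E'] [NormedSpace ℂ E'] {F : E → ℂ} {φ : E' → E} {L : E' →L[ℂ] E} {x : E'}
    (hF : DifferentiableAt ℂ F (φ x)) (hφ : HasFDerivAt φ L x) (u : E') :
    (fderiv ℂ (fun y => F (φ y)) x).toLinearMap u = (fderiv ℂ F (φ x)).toLinearMap (L u) := by
  have h : HasFDerivAt (fun y => F (φ y)) _ x := HasFDerivAt.comp x hF.hasFDerivAt hφ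
  rw [h.fderiv]
  rfl

section Covectors

variable {n d : ℕ}

theorem covX_eq {α : Module.Dual ℂ (PhaseSpace n d)} {x : Matrix (Fin d) (Fin n) ℂ}
    {ξ : Matrix (Fin n) (Fin d) ℂ} (h : ∀ m, α m = (x * m.1 + m.2 * ξ).trace) : covX α = x :=
  traceDual_eq fun A => (h (A, 0)).trans (by simp)

theorem covXi_eq {α : Module.Dual ℂ (PhaseSpace n d)} {x : Matrix (Fin d) (Fin n) ℂ}
    {ξ : Matrix (Fin n) (Fin d) ℂ} (h : ∀ m, α m = (x * m.1 + m.2 * ξ).trace) : covXi α = ξ :=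
  traceDual_eq fun A => (h (0, A)).trans (by simp [trace_mul_comm A])

theorem apply_eq_trace (α : Module.Dual ℂ (PhaseSpace n d)) (m : PhaseSpace n d) :
    α m = (covX α * m.1 + m.2 * covXi α).trace := trace_cov α m.1 m.2

theorem poissonTensor_of_trace (R : Mat n →ₗ[ℂ] Mat n) (ρ : Mat d →ₗ[ℂ] Mat d) (lam : ℂ)
    (m : PhaseSpace n d) {α β : Module.Dual ℂ (PhaseSpace n d)} {x y : Matrix (Fin d) (Fin n) ℂ}
    {ξ η : Matrix (Fin n) (Fin d) ℂ} (hα : ∀ m, α m = (x * m.1 + m.2 * ξ).trace)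
    (hβ : ∀ m, β m = (y * m.1 + m.2 * η).trace) :
    poissonTensor R ρ lam m α β = (1 / 2 : ℂ) *
      (-((m.1 * x - ξ * m.2) * R (m.1 * y - η * m.2)).trace
        - ((x * m.1 - m.2 * ξ) * ρ (y * m.1 - m.2 * η)).trace
        - (m.2 * m.1 * (y * ξ - x * η)).trace
        - (m.1 * m.2 * (ξ * y - η * x)).trace
        + 2 * lam * (x * η - y * ξ).trace) := by
  rw [poissonTensor, covX_eq hα, covX_eq hβ, covXi_eq hα, covXi_eq hβ]

end Covectors

/-! ### The action of `GL(n, ℂ)` -/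

section ActionG

variable {n d : ℕ}

theorem analyticAt_actG {g : Mat n} (hg : IsUnit g) (m : PhaseSpace n d) :
    AnalyticAt ℂ (fun p : Mat n × PhaseSpace n d => actG p.1 p.2) (g, m) := by
  have h1 : AnalyticAt ℂ (fun p : Mat n × PhaseSpace n d => p.1⁻¹) (g, m) :=
    AnalyticAt.fun_comp_of_eq (analyticAt_matrix_inv hg) analyticAt_fst rfl
  have h2 : AnalyticAt ℂ (fun p : Mat n × PhaseSpace n d => p.2) (g, m) := analyticAt_snd
  exact (analyticAt_matrix_mul analyticAt_fst
    (AnalyticAt.fun_comp_of_eq analyticAt_fst h2 rfl)).prod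
    (analyticAt_matrix_mul (AnalyticAt.fun_comp_of_eq analyticAt_snd h2 rfl) h1)

theorem exists_hasFDerivAt_actG {g : Mat n} (hg : IsUnit g) (m : PhaseSpace n d) :
    ∃ L : Mat n →L[ℂ] PhaseSpace n d, HasFDerivAt (fun a => actG a m) L g ∧
      ∀ u, L u = (u * m.1, -(m.2 * (g⁻¹ * u * g⁻¹))) := by
  obtain ⟨L, hL, hLu⟩ := exists_hasFDerivAt_matrix_inv hg
  obtain ⟨L₁, hL₁, hLu₁⟩ := hasFDerivAt_matrix_mul (hasFDerivAt_id g) (hasFDerivAt_const m.1 g)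
  obtain ⟨L₂, hL₂, hLu₂⟩ := hasFDerivAt_matrix_mul (hasFDerivAt_const m.2 g) hL
  refine ⟨L₁.prod L₂, hL₁.prodMk hL₂, fun u => Prod.ext ?_ ?_⟩
  · change L₁ u = u * m.1
    rw [hLu₁]
    change u * m.1 + g * 0 = u * m.1
    rw [Matrix.mul_zero, add_zero]
  · change L₂ u = -(m.2 * (g⁻¹ * u * g⁻¹))
    rw [hLu₂]
    change 0 * g⁻¹ + m.2 * L u = _
    rw [hLu]
    change 0 * g⁻¹ + m.2 * -(g⁻¹ * u * g⁻¹) = -(m.2 * (g⁻¹ * u * g⁻¹))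
    rw [Matrix.zero_mul, zero_add, Matrix.mul_neg]

theorem apply_actG_left {g : Mat n} (hg : IsUnit g) (m : PhaseSpace n d)
    (α : Module.Dual ℂ (PhaseSpace n d)) (A : Mat n) :
    α (A * g * m.1, -(m.2 * (g⁻¹ * (A * g) * g⁻¹))) =
      (((actG g m).1 * covX α - covXi α * (actG g m).2) * A).trace := by
  rw [apply_eq_trace]
  generalize covX α = x
  generalize covXi α = ξ
  have hdet := (isUnit_iff_isUnit_det g).mp hg
  have tx : ∀ W : Matrix (Fin n) (Fin d) ℂ, (x * W).trace = (W * x).trace := trace_mul_comm _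
  have tξ : ∀ W : Matrix (Fin d) (Fin n) ℂ, (ξ * W).trace = (W * ξ).trace := trace_mul_comm _
  have tv : ∀ W : Matrix (Fin d) (Fin n) ℂ, (m.1 * W).trace = (W * m.1).trace := trace_mul_comm _
  have tw : ∀ W : Matrix (Fin n) (Fin d) ℂ, (m.2 * W).trace = (W * m.2).trace := trace_mul_comm _
  have tg : ∀ W : Mat n, (g * W).trace = (W * g).trace := trace_mul_comm _
  have tg' : ∀ W : Mat n, (g⁻¹ * W).trace = (W * g⁻¹).trace := trace_mul_comm _
  simp only [actG, Matrix.sub_mul, Matrix.neg_mul, trace_add, trace_sub, trace_neg,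
    Matrix.mul_assoc, mul_nonsing_inv _ hdet, Matrix.mul_one, tx, tξ, tv, tw, tg, tg']
  ring

theorem apply_actG_right {g : Mat n} (hg : IsUnit g) (m : PhaseSpace n d)
    (α : Module.Dual ℂ (PhaseSpace n d)) (A : Mat n) :
    α (g * A * m.1, -(m.2 * (g⁻¹ * (g * A) * g⁻¹))) =
      ((m.1 * (covX α * g) - (g⁻¹ * covXi α) * m.2) * A).trace := by
  rw [apply_eq_trace]
  generalize covX α = x
  generalize covXi α = ξ
  have hdet := (isUnit_iff_isUnit_det g).mp hg
  have tx : ∀ W : Matrix (Fin n) (Fin d) ℂ, (x * W).trace = (W * x).trace := trace_mul_comm _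
  have tξ : ∀ W : Matrix (Fin d) (Fin n) ℂ, (ξ * W).trace = (W * ξ).trace := trace_mul_comm _
  have tv : ∀ W : Matrix (Fin d) (Fin n) ℂ, (m.1 * W).trace = (W * m.1).trace := trace_mul_comm _
  have tw : ∀ W : Matrix (Fin n) (Fin d) ℂ, (m.2 * W).trace = (W * m.2).trace := trace_mul_comm _
  have tg : ∀ W : Mat n, (g * W).trace = (W * g).trace := trace_mul_comm _
  have tg' : ∀ W : Mat n, (g⁻¹ * W).trace = (W * g⁻¹).trace := trace_mul_comm _
  simp only [Matrix.sub_mul, Matrix.neg_mul, trace_add, trace_sub, trace_neg,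
    Matrix.mul_assoc, nonsing_inv_mul_cancel_left _ _ hdet, tx, tξ, tv, tw, tg, tg']
  ring

theorem leftDeriv_actG {F : PhaseSpace n d → ℂ} {g : Mat n} (hg : IsUnit g) {m : PhaseSpace n d}
    (hF : DifferentiableAt ℂ F (actG g m)) :
    leftDeriv (fun a => F (actG a m)) g =
      (actG g m).1 * covX (fderiv ℂ F (actG g m)).toLinearMap -
        covXi (fderiv ℂ F (actG g m)).toLinearMap * (actG g m).2 := by
  obtain ⟨L, hL, hLu⟩ := exists_hasFDerivAt_actG hg m
  exact traceDual_eq fun A =>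
    (fderiv_comp_toLinearMap (φ := fun a => actG a m) hF hL (A * g)).trans
      ((congrArg _ (hLu _)).trans (apply_actG_left hg m _ A))

theorem rightDeriv_actG {F : PhaseSpace n d → ℂ} {g : Mat n} (hg : IsUnit g) {m : PhaseSpace n d}
    (hF : DifferentiableAt ℂ F (actG g m)) :
    rightDeriv (fun a => F (actG a m)) g =
      m.1 * (covX (fderiv ℂ F (actG g m)).toLinearMap * g) -
        (g⁻¹ * covXi (fderiv ℂ F (actG g m)).toLinearMap) * m.2 := by
  obtain ⟨L, hL, hLu⟩ := exists_hasFDerivAt_actG hg m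
  exact traceDual_eq fun A =>
    (fderiv_comp_toLinearMap (φ := fun a => actG a m) hF hL (g * A)).trans
      ((congrArg _ (hLu _)).trans (apply_actG_right hg m _ A))

/-- The pull-back of the covector `(xᵀ, ξ)` by `m ↦ g · m` is `(xᵀ g, g⁻¹ ξ)`. -/
theorem fderiv_comp_actG_apply {F : PhaseSpace n d → ℂ} {g : Mat n} {m : PhaseSpace n d}
    (hF : DifferentiableAt ℂ F (actG g m)) (u : PhaseSpace n d) :
    (fderiv ℂ (fun x => F (actG g x)) m).toLinearMap u =
      (covX (fderiv ℂ F (actG g m)).toLinearMap * g * u.1 +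
        u.2 * (g⁻¹ * covXi (fderiv ℂ F (actG g m)).toLinearMap)).trace := by
  let L : PhaseSpace n d →ₗ[ℂ] PhaseSpace n d :=
    { toFun := actG g
      map_add' := fun x y => Prod.ext (Matrix.mul_add _ _ _) (Matrix.add_mul _ _ _)
      map_smul' := fun r x => Prod.ext (Matrix.mul_smul _ _ _) (Matrix.smul_mul _ _ _) }
  refine (fderiv_comp_toLinearMap hF L.toContinuousLinearMap.hasFDerivAt u).trans ?_
  change (fderiv ℂ F (actG g m)).toLinearMap (actG g u) = _
  rw [apply_eq_trace, Matrix.mul_assoc, ← Matrix.mul_assoc u.2]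
  rfl

/-- How the Poisson tensor changes under `m ↦ g · m`; `α'` and `β'` are the pull-backs of the
covectors `α` and `β`. -/
theorem poissonTensor_actG (R : Mat n →ₗ[ℂ] Mat n) (ρ : Mat d →ₗ[ℂ] Mat d) (lam : ℂ) {g : Mat n}
    (hg : IsUnit g) (m : PhaseSpace n d) {α β α' β' : Module.Dual ℂ (PhaseSpace n d)}
    (hα : ∀ u, α' u = (covX α * g * u.1 + u.2 * (g⁻¹ * covXi α)).trace)
    (hβ : ∀ u, β' u = (covX β * g * u.1 + u.2 * (g⁻¹ * covXi β)).trace) :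
    poissonTensor R ρ lam (actG g m) α β =
      ((((actG g m).1 * covX α - covXi α * (actG g m).2) *
          ((-1 / 2 : ℂ) • R) ((actG g m).1 * covX β - covXi β * (actG g m).2)).trace -
        ((m.1 * (covX α * g) - (g⁻¹ * covXi α) * m.2) *
          ((-1 / 2 : ℂ) • R) (m.1 * (covX β * g) - (g⁻¹ * covXi β) * m.2)).trace) +
      poissonTensor R ρ lam m α' β' := by
  have hdet := (isUnit_iff_isUnit_det g).mp hg
  have tg : ∀ W : Mat n, (g * W).trace = (W * g).trace := trace_mul_comm _
  rw [poissonTensor_of_trace R ρ lam m hα hβ, poissonTensor]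
  generalize covX α = x
  generalize covXi α = ξ
  generalize covX β = y
  generalize covXi β = η
  simp only [actG, LinearMap.smul_apply, mul_smul_comm, trace_smul, smul_eq_mul]
  generalize R (g * m.1 * y - η * (m.2 * g⁻¹)) = r₁
  generalize R (m.1 * (y * g) - g⁻¹ * η * m.2) = r₂
  simp only [Matrix.mul_assoc]
  generalize ρ (y * (g * m.1) - m.2 * (g⁻¹ * η)) = r₃
  simp only [Matrix.mul_sub, Matrix.sub_mul, trace_sub, Matrix.mul_assoc, tg,
    nonsing_inv_mul_cancel_left _ _ hdet, mul_nonsing_inv_cancel_left _ _ hdet]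
  ring

theorem isPoissonAction_actG {R : Mat n →ₗ[ℂ] Mat n} (hR : IsRMatrix R) {ρ : Mat d →ₗ[ℂ] Mat d}
    (hρ : IsRMatrix ρ) (lam : ℂ) :
    IsPoissonAction (sklyanin ((-1 / 2 : ℂ) • R)) (bracketOf (poissonTensor R ρ lam))
      (actG (n := n) (d := d)) where
  group := hR.isPoissonLieGroup _
  space := isPoissonBracket_phaseSpace lam hR hρ
  one_act m := by simp [actG]
  mul_act g _ h _ m := by simp [actG, Matrix.mul_assoc, Matrix.mul_inv_rev]
  holomorphic p hp := analyticAt_actG hp.1 p.2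
  poisson F H hF hH g hg m := by
    have hF' := (hF (actG g m) (Set.mem_univ _)).differentiableAt
    have hH' := (hH (actG g m) (Set.mem_univ _)).differentiableAt
    rw [sklyanin, leftDeriv_actG hg hF', leftDeriv_actG hg hH', rightDeriv_actG hg hF',
      rightDeriv_actG hg hH']
    exact poissonTensor_actG R ρ lam hg m (fderiv_comp_actG_apply hF') (fderiv_comp_actG_apply hH')

theorem infAction_actG (X : Mat n) (m : PhaseSpace n d) :
    infAction actG X m = (X * m.1, -(m.2 * X)) := by
  have h1 := hasDerivAt_matrix_mul (hasDerivAt_exp_smul_mat X) (hasDerivAt_const (0 : ℂ) m.1)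
  have h2 := hasDerivAt_matrix_mul (hasDerivAt_const (0 : ℂ) m.2) (hasDerivAt_exp_smul_mat_inv X)
  refine (h1.prodMk h2).deriv.trans ?_
  simp

end ActionG

/-! ### The action of `GL(d, ℂ)` -/

section ActionH

variable {n d : ℕ}

theorem analyticAt_actH {h : Mat d} (hh : IsUnit h) (m : PhaseSpace n d) :
    AnalyticAt ℂ (fun p : Mat d × PhaseSpace n d => actH p.1 p.2) (h, m) := by
  have h1 : AnalyticAt ℂ (fun p : Mat d × PhaseSpace n d => p.1⁻¹) (h, m) :=
    AnalyticAt.fun_comp_of_eq (analyticAt_matrix_inv hh) analyticAt_fst rfl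
  have h2 : AnalyticAt ℂ (fun p : Mat d × PhaseSpace n d => p.2) (h, m) := analyticAt_snd
  exact (analyticAt_matrix_mul (AnalyticAt.fun_comp_of_eq analyticAt_fst h2 rfl) h1).prod
    (analyticAt_matrix_mul analyticAt_fst (AnalyticAt.fun_comp_of_eq analyticAt_snd h2 rfl))

theorem exists_hasFDerivAt_actH {h : Mat d} (hh : IsUnit h) (m : PhaseSpace n d) :
    ∃ L : Mat d →L[ℂ] PhaseSpace n d, HasFDerivAt (fun a => actH a m) L h ∧
      ∀ u, L u = (-(m.1 * (h⁻¹ * u * h⁻¹)), u * m.2) := by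
  obtain ⟨L, hL, hLu⟩ := exists_hasFDerivAt_matrix_inv hh
  obtain ⟨L₁, hL₁, hLu₁⟩ := hasFDerivAt_matrix_mul (hasFDerivAt_const m.1 h) hL
  obtain ⟨L₂, hL₂, hLu₂⟩ := hasFDerivAt_matrix_mul (hasFDerivAt_id h) (hasFDerivAt_const m.2 h)
  refine ⟨L₁.prod L₂, hL₁.prodMk hL₂, fun u => Prod.ext ?_ ?_⟩
  · change L₁ u = -(m.1 * (h⁻¹ * u * h⁻¹))
    rw [hLu₁]
    change 0 * h⁻¹ + m.1 * L u = _
    rw [hLu]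
    change 0 * h⁻¹ + m.1 * -(h⁻¹ * u * h⁻¹) = -(m.1 * (h⁻¹ * u * h⁻¹))
    rw [Matrix.zero_mul, zero_add, Matrix.mul_neg]
  · change L₂ u = u * m.2
    rw [hLu₂]
    change u * m.2 + h * 0 = u * m.2
    rw [Matrix.mul_zero, add_zero]

theorem apply_actH_left {h : Mat d} (hh : IsUnit h) (m : PhaseSpace n d)
    (α : Module.Dual ℂ (PhaseSpace n d)) (A : Mat d) :
    α (-(m.1 * (h⁻¹ * (A * h) * h⁻¹)), A * h * m.2) =
      (-(covX α * (actH h m).1 - (actH h m).2 * covXi α) * A).trace := by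
  rw [apply_eq_trace]
  generalize covX α = x
  generalize covXi α = ξ
  have hdet := (isUnit_iff_isUnit_det h).mp hh
  have tx : ∀ W : Matrix (Fin n) (Fin d) ℂ, (x * W).trace = (W * x).trace := trace_mul_comm _
  have tξ : ∀ W : Matrix (Fin d) (Fin n) ℂ, (ξ * W).trace = (W * ξ).trace := trace_mul_comm _
  have tv : ∀ W : Matrix (Fin d) (Fin n) ℂ, (m.1 * W).trace = (W * m.1).trace := trace_mul_comm _
  have tw : ∀ W : Matrix (Fin n) (Fin d) ℂ, (m.2 * W).trace = (W * m.2).trace := trace_mul_comm _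
  have th : ∀ W : Mat d, (h * W).trace = (W * h).trace := trace_mul_comm _
  have th' : ∀ W : Mat d, (h⁻¹ * W).trace = (W * h⁻¹).trace := trace_mul_comm _
  simp only [actH, Matrix.sub_mul, Matrix.neg_mul, Matrix.mul_neg, trace_add, trace_sub, trace_neg,
    Matrix.mul_assoc, mul_nonsing_inv _ hdet, Matrix.mul_one, tx, tξ, tv, tw, th, th']
  ring

theorem apply_actH_right {h : Mat d} (hh : IsUnit h) (m : PhaseSpace n d)
    (α : Module.Dual ℂ (PhaseSpace n d)) (A : Mat d) :
    α (-(m.1 * (h⁻¹ * (h * A) * h⁻¹)), h * A * m.2) =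
      (-((h⁻¹ * covX α) * m.1 - m.2 * (covXi α * h)) * A).trace := by
  rw [apply_eq_trace]
  generalize covX α = x
  generalize covXi α = ξ
  have hdet := (isUnit_iff_isUnit_det h).mp hh
  have tx : ∀ W : Matrix (Fin n) (Fin d) ℂ, (x * W).trace = (W * x).trace := trace_mul_comm _
  have tξ : ∀ W : Matrix (Fin d) (Fin n) ℂ, (ξ * W).trace = (W * ξ).trace := trace_mul_comm _
  have tv : ∀ W : Matrix (Fin d) (Fin n) ℂ, (m.1 * W).trace = (W * m.1).trace := trace_mul_comm _
  have tw : ∀ W : Matrix (Fin n) (Fin d) ℂ, (m.2 * W).trace = (W * m.2).trace := trace_mul_comm _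
  have th : ∀ W : Mat d, (h * W).trace = (W * h).trace := trace_mul_comm _
  have th' : ∀ W : Mat d, (h⁻¹ * W).trace = (W * h⁻¹).trace := trace_mul_comm _
  simp only [Matrix.sub_mul, Matrix.neg_mul, Matrix.mul_neg, trace_add, trace_sub, trace_neg,
    Matrix.mul_assoc, nonsing_inv_mul_cancel_left _ _ hdet, tx, tξ, tv, tw, th, th']
  ring

theorem leftDeriv_actH {F : PhaseSpace n d → ℂ} {h : Mat d} (hh : IsUnit h) {m : PhaseSpace n d}
    (hF : DifferentiableAt ℂ F (actH h m)) :
    leftDeriv (fun a => F (actH a m)) h =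
      -(covX (fderiv ℂ F (actH h m)).toLinearMap * (actH h m).1 -
        (actH h m).2 * covXi (fderiv ℂ F (actH h m)).toLinearMap) := by
  obtain ⟨L, hL, hLu⟩ := exists_hasFDerivAt_actH hh m
  exact traceDual_eq fun A =>
    (fderiv_comp_toLinearMap (φ := fun a => actH a m) hF hL (A * h)).trans
      ((congrArg _ (hLu _)).trans (apply_actH_left hh m _ A))

theorem rightDeriv_actH {F : PhaseSpace n d → ℂ} {h : Mat d} (hh : IsUnit h) {m : PhaseSpace n d}
    (hF : DifferentiableAt ℂ F (actH h m)) :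
    rightDeriv (fun a => F (actH a m)) h =
      -((h⁻¹ * covX (fderiv ℂ F (actH h m)).toLinearMap) * m.1 -
        m.2 * (covXi (fderiv ℂ F (actH h m)).toLinearMap * h)) := by
  obtain ⟨L, hL, hLu⟩ := exists_hasFDerivAt_actH hh m
  exact traceDual_eq fun A =>
    (fderiv_comp_toLinearMap (φ := fun a => actH a m) hF hL (h * A)).trans
      ((congrArg _ (hLu _)).trans (apply_actH_right hh m _ A))

theorem apply_actH (α : Module.Dual ℂ (PhaseSpace n d)) (h : Mat d) (u : PhaseSpace n d) :
    α (actH h u) = (h⁻¹ * covX α * u.1 + u.2 * (covXi α * h)).trace := by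
  have th : ∀ W : Mat d, (h * W).trace = (W * h).trace := trace_mul_comm _
  have th' : ∀ W : Mat d, (h⁻¹ * W).trace = (W * h⁻¹).trace := trace_mul_comm _
  rw [apply_eq_trace]
  simp only [actH, trace_add, Matrix.mul_assoc, th, th']

/-- The pull-back of the covector `(xᵀ, ξ)` by `m ↦ h · m` is `(h⁻¹ xᵀ, ξ h)`. -/
theorem fderiv_comp_actH_apply {F : PhaseSpace n d → ℂ} {h : Mat d} {m : PhaseSpace n d}
    (hF : DifferentiableAt ℂ F (actH h m)) (u : PhaseSpace n d) :
    (fderiv ℂ (fun x => F (actH h x)) m).toLinearMap u =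
      (h⁻¹ * covX (fderiv ℂ F (actH h m)).toLinearMap * u.1 +
        u.2 * (covXi (fderiv ℂ F (actH h m)).toLinearMap * h)).trace := by
  let L : PhaseSpace n d →ₗ[ℂ] PhaseSpace n d :=
    { toFun := actH h
      map_add' := fun x y => Prod.ext (Matrix.add_mul _ _ _) (Matrix.mul_add _ _ _)
      map_smul' := fun r x => Prod.ext (Matrix.smul_mul _ _ _) (Matrix.mul_smul _ _ _) }
  exact (fderiv_comp_toLinearMap hF L.toContinuousLinearMap.hasFDerivAt u).trans
    (apply_actH _ h u)

/-- How the Poisson tensor changes under `m ↦ h · m`; `α'` and `β'` are the pull-backs of the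
covectors `α` and `β`. -/
theorem poissonTensor_actH (R : Mat n →ₗ[ℂ] Mat n) (ρ : Mat d →ₗ[ℂ] Mat d) (lam : ℂ) {h : Mat d}
    (hh : IsUnit h) (m : PhaseSpace n d) {α β α' β' : Module.Dual ℂ (PhaseSpace n d)}
    (hα : ∀ u, α' u = (h⁻¹ * covX α * u.1 + u.2 * (covXi α * h)).trace)
    (hβ : ∀ u, β' u = (h⁻¹ * covX β * u.1 + u.2 * (covXi β * h)).trace) :
    poissonTensor R ρ lam (actH h m) α β =
      ((-(covX α * (actH h m).1 - (actH h m).2 * covXi α) *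
          ((-1 / 2 : ℂ) • ρ) (-(covX β * (actH h m).1 - (actH h m).2 * covXi β))).trace -
        (-((h⁻¹ * covX α) * m.1 - m.2 * (covXi α * h)) *
          ((-1 / 2 : ℂ) • ρ) (-((h⁻¹ * covX β) * m.1 - m.2 * (covXi β * h)))).trace) +
      poissonTensor R ρ lam m α' β' := by
  have hdet := (isUnit_iff_isUnit_det h).mp hh
  have th : ∀ W : Mat d, (h * W).trace = (W * h).trace := trace_mul_comm _
  have th' : ∀ W : Mat d, (h⁻¹ * W).trace = (W * h⁻¹).trace := trace_mul_comm _
  rw [poissonTensor_of_trace R ρ lam m hα hβ, poissonTensor]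
  generalize covX α = x
  generalize covXi α = ξ
  generalize covX β = y
  generalize covXi β = η
  simp only [map_neg, neg_mul_neg]
  simp only [actH, LinearMap.smul_apply, mul_smul_comm, trace_smul, smul_eq_mul]
  generalize ρ (y * (m.1 * h⁻¹) - h * m.2 * η) = r₁
  generalize ρ (h⁻¹ * y * m.1 - m.2 * (η * h)) = r₂
  simp only [Matrix.mul_assoc]
  generalize R (m.1 * (h⁻¹ * y) - η * (h * m.2)) = r₃
  simp only [Matrix.mul_sub, Matrix.sub_mul, trace_sub, Matrix.mul_assoc, th, th',
    nonsing_inv_mul_cancel_left _ _ hdet, mul_nonsing_inv_cancel_left _ _ hdet,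
    mul_nonsing_inv _ hdet, Matrix.mul_one]
  ring

theorem isPoissonAction_actH {R : Mat n →ₗ[ℂ] Mat n} (hR : IsRMatrix R) {ρ : Mat d →ₗ[ℂ] Mat d}
    (hρ : IsRMatrix ρ) (lam : ℂ) :
    IsPoissonAction (sklyanin ((-1 / 2 : ℂ) • ρ)) (bracketOf (poissonTensor R ρ lam))
      (actH (n := n) (d := d)) where
  group := hρ.isPoissonLieGroup _
  space := isPoissonBracket_phaseSpace lam hR hρ
  one_act m := by simp [actH]
  mul_act g _ h _ m := by simp [actH, Matrix.mul_assoc, Matrix.mul_inv_rev]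
  holomorphic p hp := analyticAt_actH hp.1 p.2
  poisson F H hF hH h hh m := by
    have hF' := (hF (actH h m) (Set.mem_univ _)).differentiableAt
    have hH' := (hH (actH h m) (Set.mem_univ _)).differentiableAt
    rw [sklyanin, leftDeriv_actH hh hF', leftDeriv_actH hh hH', rightDeriv_actH hh hF',
      rightDeriv_actH hh hH']
    exact poissonTensor_actH R ρ lam hh m (fderiv_comp_actH_apply hF') (fderiv_comp_actH_apply hH')

theorem infAction_actH (X : Mat d) (m : PhaseSpace n d) :
    infAction actH X m = (-(m.1 * X), X * m.2) := by
  have h1 := hasDerivAt_matrix_mul (hasDerivAt_const (0 : ℂ) m.1) (hasDerivAt_exp_smul_mat_inv X)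
  have h2 := hasDerivAt_matrix_mul (hasDerivAt_exp_smul_mat X) (hasDerivAt_const (0 : ℂ) m.2)
  refine (h1.prodMk h2).deriv.trans ?_
  simp

end ActionH

/-! ### The two momentum maps -/

section MomentumMaps

variable {n d : ℕ}

/-- The Hamiltonian vector in components; `A = R (v xᵀ - ξ wᵀ)` and `B = ρ (wᵀ ξ - xᵀ v)`. -/
theorem phaseVector_eq (R : Mat n →ₗ[ℂ] Mat n) (ρ : Mat d →ₗ[ℂ] Mat d) (lam : ℂ)
    (m : PhaseSpace n d) (α : Module.Dual ℂ (PhaseSpace n d)) {A : Mat n} {B : Mat d}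
    (hA : R (m.1 * covX α - covXi α * m.2) = A) (hB : ρ (m.2 * covXi α - covX α * m.1) = B) :
    phaseVector R ρ lam m α =
      ((1 / 2 : ℂ) • (A * m.1 - m.1 * B -
          ((m.1 * m.2 + lam • 1) * covXi α + covXi α * (m.2 * m.1 + lam • 1))),
        (1 / 2 : ℂ) • (B * m.2 - m.2 * A +
          ((m.2 * m.1 + lam • 1) * covX α + covX α * (m.1 * m.2 + lam • 1)))) := by
  have h1 : blockMoment R ρ m α = fromBlocks A 0 0 B := by
    rw [blockMoment, covBlock, oddBlock_commutator, ← hA, ← hB]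
    rfl
  have h2 : oddBlock m * oddBlock m + lam • (1 : Matrix (Fin n ⊕ Fin d) (Fin n ⊕ Fin d) ℂ) =
      fromBlocks (m.1 * m.2 + lam • 1) 0 0 (m.2 * m.1 + lam • 1) := by
    rw [← fromBlocks_one, fromBlocks_smul]
    simp [oddBlock_apply, fromBlocks_multiply, fromBlocks_add]
  rw [phaseVector, blockVector, h1, h2, map_smul, covBlock, oddBlock_apply, oddBlock_apply, grading]
  simp only [fromBlocks_multiply, fromBlocks_add, map_sub, oddPart_fromBlocks,
    Matrix.mul_zero, Matrix.zero_mul, add_zero, zero_add, Matrix.one_mul, Matrix.neg_mul]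
  refine Prod.ext rfl ?_
  change (1 / 2 : ℂ) • (B * m.2 - m.2 * A - -_) = _
  rw [sub_neg_eq_add]

theorem rPlus_mul_sub_mul_rMinus {k : ℕ} (R : Mat k →ₗ[ℂ] Mat k) (Y M : Mat k) :
    rPlus R Y * M - M * rMinus R Y =
      (1 / 2 : ℂ) • (R Y * M - M * R Y + (Y * M + M * Y)) := by
  rw [rPlus_apply, rMinus_apply, smul_mul_assoc, mul_smul_comm, ← smul_sub, add_mul, mul_sub]
  congr 1
  abel

theorem analyticAt_PhiG (lam : ℂ) (m : PhaseSpace n d) : AnalyticAt ℂ (PhiG lam) m := by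
  have h : AnalyticAt ℂ (fun m : PhaseSpace n d => m) m := analyticAt_id
  exact analyticAt_const.add (analyticAt_matrix_mul
    (AnalyticAt.fun_comp_of_eq analyticAt_fst h rfl)
    (AnalyticAt.fun_comp_of_eq analyticAt_snd h rfl))

theorem fderiv_PhiG_apply (lam : ℂ) (m u : PhaseSpace n d) :
    fderiv ℂ (PhiG lam) m u = u.1 * m.2 + m.1 * u.2 := by
  obtain ⟨L, hL, hLu⟩ := hasFDerivAt_matrix_mul (hasFDerivAt_fst (𝕜 := ℂ) (p := m))
    (hasFDerivAt_snd (𝕜 := ℂ) (p := m))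
  have h : HasFDerivAt (PhiG lam) L m := hL.const_add (lam • (1 : Mat n))
  refine (congrArg (fun T : PhaseSpace n d →L[ℂ] Mat n => T u) h.fderiv).trans ?_
  exact hLu u

/-- The Hamiltonian vector moves `λ + v wᵀ` by `Y₊ Φ - Φ Y₋` with `Y = v xᵀ - ξ wᵀ`. The terms
with `ρ` cancel since `(v B) wᵀ = v (B wᵀ)`. -/
theorem fderiv_PhiG_phaseVector (R : Mat n →ₗ[ℂ] Mat n) (ρ : Mat d →ₗ[ℂ] Mat d) (lam : ℂ)
    (m : PhaseSpace n d) (α : Module.Dual ℂ (PhaseSpace n d)) :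
    fderiv ℂ (PhiG lam) m (phaseVector R ρ lam m α) =
      rPlus R (m.1 * covX α - covXi α * m.2) * PhiG lam m -
        PhiG lam m * rMinus R (m.1 * covX α - covXi α * m.2) := by
  rw [fderiv_PhiG_apply, rPlus_mul_sub_mul_rMinus, phaseVector_eq R ρ lam m α rfl rfl]
  generalize R _ = A
  generalize ρ _ = B
  simp only [PhiG, Matrix.smul_mul, Matrix.mul_smul, ← smul_add]
  congr 1
  simp only [Matrix.mul_add, Matrix.add_mul, Matrix.mul_sub, Matrix.sub_mul, Matrix.smul_mul,
    Matrix.mul_smul, Matrix.mul_one, Matrix.one_mul, Matrix.mul_assoc, smul_sub]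
  abel

/-- The motion of `λ + wᵀ v` along the Hamiltonian vector. -/
theorem phaseVector_snd_mul_add (R : Mat n →ₗ[ℂ] Mat n) (ρ : Mat d →ₗ[ℂ] Mat d) (lam : ℂ)
    (m : PhaseSpace n d) (α : Module.Dual ℂ (PhaseSpace n d)) :
    (phaseVector R ρ lam m α).2 * m.1 + m.2 * (phaseVector R ρ lam m α).1 =
      (1 / 2 : ℂ) • (ρ (m.2 * covXi α - covX α * m.1) * (lam • (1 : Mat d) + m.2 * m.1) -
        (lam • (1 : Mat d) + m.2 * m.1) * ρ (m.2 * covXi α - covX α * m.1) -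
        ((m.2 * covXi α - covX α * m.1) * (lam • (1 : Mat d) + m.2 * m.1) +
          (lam • (1 : Mat d) + m.2 * m.1) * (m.2 * covXi α - covX α * m.1))) := by
  rw [phaseVector_eq R ρ lam m α rfl rfl]
  generalize R _ = A
  generalize ρ _ = B
  simp only [Matrix.smul_mul, Matrix.mul_smul, ← smul_add]
  congr 1
  simp only [Matrix.mul_add, Matrix.add_mul, Matrix.mul_sub, Matrix.sub_mul, Matrix.smul_mul,
    Matrix.mul_smul, Matrix.mul_one, Matrix.one_mul, Matrix.mul_assoc, smul_sub]
  abel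

theorem isUnit_of_isUnit_PhiH {lam : ℂ} {m : PhaseSpace n d} (h : IsUnit (PhiH lam m)) :
    IsUnit (lam • (1 : Mat d) + m.2 * m.1) := isUnit_nonsing_inv_iff.mp h

theorem analyticAt_PhiH {lam : ℂ} {m : PhaseSpace n d} (hm : IsUnit (PhiH lam m)) :
    AnalyticAt ℂ (PhiH lam) m := by
  have h : AnalyticAt ℂ (fun m : PhaseSpace n d => m) m := analyticAt_id
  have h1 : AnalyticAt ℂ (fun m : PhaseSpace n d => lam • (1 : Mat d) + m.2 * m.1) m :=
    analyticAt_const.add (analyticAt_matrix_mul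
      (AnalyticAt.fun_comp_of_eq analyticAt_snd h rfl)
      (AnalyticAt.fun_comp_of_eq analyticAt_fst h rfl))
  have h2 : AnalyticAt ℂ (fun m : PhaseSpace n d => (lam • (1 : Mat d) + m.2 * m.1)⁻¹) m :=
    AnalyticAt.fun_comp_of_eq (analyticAt_matrix_inv (isUnit_of_isUnit_PhiH hm)) h1 rfl
  exact h2

theorem fderiv_PhiH_apply {lam : ℂ} {m : PhaseSpace n d} (hm : IsUnit (PhiH lam m))
    (u : PhaseSpace n d) :
    fderiv ℂ (PhiH lam) m u = -(PhiH lam m * (u.2 * m.1 + m.2 * u.1) * PhiH lam m) := by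
  obtain ⟨L, hL, hLu⟩ := hasFDerivAt_matrix_mul (hasFDerivAt_snd (𝕜 := ℂ) (p := m))
    (hasFDerivAt_fst (𝕜 := ℂ) (p := m))
  have h : HasFDerivAt (fun m : PhaseSpace n d => lam • (1 : Mat d) + m.2 * m.1) L m :=
    hL.const_add (lam • (1 : Mat d))
  obtain ⟨T, hT, hTu⟩ := exists_hasFDerivAt_matrix_inv (isUnit_of_isUnit_PhiH hm)
  have h2 : HasFDerivAt (PhiH lam) (T.comp L) m := HasFDerivAt.comp m hT h
  refine (congrArg (fun T : PhaseSpace n d →L[ℂ] Mat d => T u) h2.fderiv).trans ?_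
  refine (hTu (L u)).trans ?_
  exact congrArg (fun w : Mat d => -(PhiH lam m * w * PhiH lam m)) (hLu u)

/-- The Hamiltonian vector moves `(λ + wᵀ v)⁻¹` by `Y₊ Φ - Φ Y₋` with `Y = wᵀ ξ - xᵀ v`. The
inverse turns the sign of the terms without `ρ`. -/
theorem fderiv_PhiH_phaseVector (R : Mat n →ₗ[ℂ] Mat n) (ρ : Mat d →ₗ[ℂ] Mat d) {lam : ℂ}
    {m : PhaseSpace n d} (hm : IsUnit (PhiH lam m)) (α : Module.Dual ℂ (PhaseSpace n d)) :
    fderiv ℂ (PhiH lam) m (phaseVector R ρ lam m α) =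
      rPlus ρ (m.2 * covXi α - covX α * m.1) * PhiH lam m -
        PhiH lam m * rMinus ρ (m.2 * covXi α - covX α * m.1) := by
  have hdet := (isUnit_iff_isUnit_det _).mp (isUnit_of_isUnit_PhiH hm)
  rw [fderiv_PhiH_apply hm, rPlus_mul_sub_mul_rMinus, phaseVector_snd_mul_add]
  generalize ρ _ = B
  generalize m.2 * covXi α - covX α * m.1 = Y
  simp only [PhiH]
  generalize lam • (1 : Mat d) + m.2 * m.1 = Ψ at *
  rw [mul_smul_comm, smul_mul_assoc, ← smul_neg]
  congr 1
  simp only [mul_sub, sub_mul, mul_add, add_mul, mul_assoc, mul_nonsing_inv _ hdet,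
    nonsing_inv_mul_cancel_left _ _ hdet, mul_one]
  abel

theorem apply_infAction_actG (m : PhaseSpace n d) (α : Module.Dual ℂ (PhaseSpace n d)) (X : Mat n) :
    α (infAction actG X m) = (X * (m.1 * covX α - covXi α * m.2)).trace := by
  rw [infAction_actG, apply_eq_trace]
  simp only [Matrix.neg_mul, mul_sub, trace_add, trace_neg, trace_sub]
  rw [trace_mul_comm (covX α), trace_mul_comm (m.2 * X), trace_mul_comm X (covXi α * m.2)]
  simp only [Matrix.mul_assoc]
  ring

theorem apply_infAction_actH (m : PhaseSpace n d) (α : Module.Dual ℂ (PhaseSpace n d)) (X : Mat d) :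
    α (infAction actH X m) = (X * (m.2 * covXi α - covX α * m.1)).trace := by
  rw [infAction_actH, apply_eq_trace]
  simp only [Matrix.mul_neg, mul_sub, trace_add, trace_neg, trace_sub]
  rw [trace_mul_comm X (covX α * m.1)]
  simp only [Matrix.mul_assoc]
  ring

theorem zero_mem_factorDomain_PhiG (R : Mat n →ₗ[ℂ] Mat n) {lam : ℂ} (hlam : lam ≠ 0) :
    (0 : PhaseSpace n d) ∈ factorDomain R (PhiG lam) :=
  exp_smul_one_mem_factorDomain (z := Complex.log lam) (by simp [PhiG, Complex.exp_log hlam])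

theorem zero_mem_factorDomain_PhiH (ρ : Mat d →ₗ[ℂ] Mat d) {lam : ℂ} (hlam : lam ≠ 0) :
    (0 : PhaseSpace n d) ∈ factorDomain ρ (PhiH lam) := by
  refine exp_smul_one_mem_factorDomain (z := -Complex.log lam) ?_
  refine inv_eq_left_inv ?_
  rw [Complex.exp_neg, Complex.exp_log hlam]
  simp [smul_smul, hlam]

end MomentumMaps

end PoissonLie

theorem proposition4 (n d : ℕ)
    (R : PoissonLie.Mat n →ₗ[ℂ] PoissonLie.Mat n) (hR : PoissonLie.IsRMatrix R)
    (ρ : PoissonLie.Mat d →ₗ[ℂ] PoissonLie.Mat d) (hρ : PoissonLie.IsRMatrix ρ)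
    (lam : ℂ) (hlam : lam ≠ 0) :
    PoissonLie.RepresentsMomentumMap R (PoissonLie.poissonTensor R ρ lam)
        PoissonLie.actG (PoissonLie.PhiG (n := n) (d := d) lam) ∧
      PoissonLie.RepresentsMomentumMap ρ (PoissonLie.poissonTensor R ρ lam)
        PoissonLie.actH (PoissonLie.PhiH (n := n) (d := d) lam) := by
  open PoissonLie in
  exact ⟨representsMomentumMap_of_hamiltonian hR (isPoissonAction_actG hR hρ lam)
      (fun m _ => analyticAt_PhiG lam m) ⟨0, zero_mem_factorDomain_PhiG R hlam⟩
      (poissonTensor_eq lam hR hρ) (fun m _ α => fderiv_PhiG_phaseVector R ρ lam m α)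
      apply_infAction_actG,
    representsMomentumMap_of_hamiltonian hρ (isPoissonAction_actH hR hρ lam)
      (fun _ hm => analyticAt_PhiH hm) ⟨0, zero_mem_factorDomain_PhiH ρ hlam⟩
      (poissonTensor_eq lam hR hρ) (fun _ hm α => fderiv_PhiH_phaseVector R ρ hm α)
      apply_infAction_actH⟩
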